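/- Let $\beta\in(-1,1)$, let $p_0$ be a positive integer with $p_0>\max\left(\frac1{4(1-\beta)},\frac1{4(1+\beta)}\right)$, write $DN(\omega)=\omega N'(\omega)$ (weak derivative on $(0,\infty)$), and let $X$ be the space of $N\in L^\infty(0,\infty)$ with $DN\in L^{2p_0}(0,\infty)\cap L^\infty(0,\infty)$, normed by $\|N\|_X=\|N\|_{L^\infty}+\|DN\|_{L^{2p_0}}+\|DN\|_{L^\infty}$. Consider the kinetic MMT equation for $N=\omega^{2\beta+3/2}n$, $$\partial_tN(\omega)=\overline{\mathcal C}(N)(\omega):=\int_0^1\frac{\left(\prod_{i=1}^4v_i\right)^{-\beta-\frac12}}{1+u+u^2}\sum_{j,k=1}^4(-1)^{j+k}v_j^{2\beta+\frac32}v_k^{2\beta-\frac12}\prod_{i\neq j}N\left(\omega\frac{v_i}{v_k}\right)du,$$ $$v_1=\tfrac{1+u}{1+u+u^2},\qquad v_2=1,\qquad v_3=\tfrac{u(1+u)}{1+u+u^2},\qquad v_4=\tfrac{u}{1+u+u^2}.$$ Let $N_0\in X$ with $\inf_{\omega>0}N_0(\omega)>0$. Then there are $T_*>0$ and finite constants $C$,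 $C'$ and $K_p$ (for integers $p\ge p_0$), where $T_*,C,C'$ depend only on $p_0,\beta,N_0$ and $K_p$ only on $p,p_0,\beta,N_0$, such that the following holds. Let $T>0$ and let $N\in L^\infty(0,T;X)$ be a strong solution on $(0,T)$ with $N(0)=N_0$, that is, $\partial_tN\in L^\infty(0,T;L^\infty(0,\infty))$, $D\partial_tN\in L^1(0,T;L^{2p_0}(0,\infty)\cap L^\infty(0,\infty))$ and $\partial_tN=\overline{\mathcal C}(N)$ for almost every $(t,\omega)$. Assume that $$\int_0^T\!\int_0^\infty\!\int_{-1/3}^1|DN(\omega)-DN(\omega(1+u))|^2\left(\mathbf 1_{[-1/3,0]}(u)|u|^{-(\beta+1)}+\mathbf 1_{[0,1]}(u)|u|^{2\beta}\right)du\,d\omega\,dt<\infty .$$ Then, with $T'=\min(T,T_*)$: (i) $\|N\|_{L^\infty(0,T';X)}\le C$. (ii) For every integer $p\ge p_0$, $$\int_0^{T'}\!\int_0^\infty\!\int_0^1|DN(\omega)-DN(\omega(1+u))|^2u^{2\beta}\left[\int_0^1|\lambda DN(\omega)+(1-\lambda)DN(\omega(1+u))|^{2(p-1)}d\lambda\right]du\,d\omega\,dt$$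 $$+\int_0^{T'}\!\int_0^\infty\!\int_0^{1/3}|DN(\omega)-DN(\omega(1-u))|^2u^{-(\beta+1)}\left[\int_0^1|\lambda DN(\omega)+(1-\lambda)DN(\omega(1-u))|^{2(p-1)}d\lambda\right]du\,d\omega\,dt\le K_p .$$ (iii) If $\beta\in(-\frac34,\frac34)$, then $\int_0^{T'}[DN(t)]_\beta^2\,dt\le C'$, where $$[F]_\beta^2=\int_0^\infty\!\int_0^\infty\mathbf 1_{[2/3,3/2]}\left(\tfrac{\omega'}{\omega}\right)\frac{|F(\omega)-F(\omega')|^2}{|\omega'-\omega|^{\beta+1}}(\omega\omega')^{\beta/2}\,d\omega\,d\omega'+\int_0^\infty\!\int_0^\infty\mathbf 1_{[1/2,2]}\left(\tfrac{\omega'}{\omega}\right)\frac{|F(\omega)-F(\omega')|^2}{|\omega'-\omega|^{-2\beta}}(\omega\omega')^{-(2\beta+1)/2}\,d\omega\,d\omega'.$$ -/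

import Mathlib

open MeasureTheory Set
open scoped ENNReal NNReal

noncomputable section

namespace KineticMMT

/-- Lebesgue measure on the frequency half-line `(0, ∞)`. -/
def halfLine : Measure ℝ := volume.restrict (Ioi 0)

/-- Lebesgue measure on the time interval `(0, T)`. -/
def timeInterval (T : ℝ) : Measure ℝ := volume.restrict (Ioo 0 T)

/-- The scaling derivative `D f (ω) = ω f'(ω)`. -/
def D (f : ℝ → ℝ) (ω : ℝ) : ℝ := ω * deriv f ω

/-- Local absolute continuity on `(0, ∞)`.  A locally integrable function on `(0, ∞)` has a locally
integrable distributional derivative iff it has such a representative, and then the distributional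
derivative is the almost everywhere defined classical one. -/
def LocallyAC (f : ℝ → ℝ) : Prop :=
  ∀ a b : ℝ, 0 < a → a ≤ b → AbsolutelyContinuousOnInterval f a b

/-- `‖f‖_X = ‖f‖_{L^∞} + ‖D f‖_{L^{2 p₀}} + ‖D f‖_{L^∞}`, all norms over `(0, ∞)`. -/
def xNorm (p₀ : ℕ) (f : ℝ → ℝ) : ℝ≥0∞ :=
  eLpNorm f ∞ halfLine + eLpNorm (D f) ((2 * p₀ : ℕ) : ℝ≥0∞) halfLine + eLpNorm (D f) ∞ halfLine

/-- The space `X = {f ∈ L^∞(0, ∞) : D f ∈ L^{2 p₀}(0, ∞) ∩ L^∞(0, ∞)}`, each class being represented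
by its continuous representative (only the values on `(0, ∞)` matter). -/
def MemX (p₀ : ℕ) (f : ℝ → ℝ) : Prop := LocallyAC f ∧ xNorm p₀ f < ∞

/-- The numbers `v₁, v₂, v₃, v₄` (with indices shifted to `0, 1, 2, 3`) that parameterize the
nontrivial resonances. -/
def v (u : ℝ) : Fin 4 → ℝ :=
  ![(1 + u) / (1 + u + u ^ 2), 1, u * (1 + u) / (1 + u + u ^ 2), u / (1 + u + u ^ 2)]

/-- The collision operator for the rescaled unknown.  The quotient `∏ᵢ N_{i,k} / N_{j,k}` is the
product over `i ≠ j`, where `N_{i,k} = N (ω vᵢ / vₖ)`. -/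
def collision (β : ℝ) (f : ℝ → ℝ) (ω : ℝ) : ℝ :=
  ∫ u in (0 : ℝ)..1, (∏ i, v u i) ^ (-β - 1 / 2) / (1 + u + u ^ 2) *
    ∑ j : Fin 4, ∑ k : Fin 4, (-1 : ℝ) ^ ((j : ℕ) + (k : ℕ)) *
      v u j ^ (2 * β + 3 / 2) * v u k ^ (2 * β - 1 / 2) *
      ∏ i ∈ Finset.univ.erase j, f (ω * v u i / v u k)

/-- `N` (a function of time and frequency) is a strong solution on `(0, T)`, in `L^∞(0, T; X)`, of
`∂ₜ N = collision β N` with initial value `N₀`, and `Nt` is its time derivative. -/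
structure IsStrongSolution (β : ℝ) (p₀ : ℕ) (T : ℝ) (N₀ : ℝ → ℝ) (N Nt : ℝ → ℝ → ℝ) : Prop where
  /-- `N ∈ L^∞(0, T; X)`. -/
  aestronglyMeasurable :
    AEStronglyMeasurable (Function.uncurry N) ((timeInterval T).prod halfLine)
  memX : ∀ᵐ t ∂(timeInterval T), MemX p₀ (N t)
  essSup_xNorm_lt_top : essSup (fun t => xNorm p₀ (N t)) (timeInterval T) < ∞
  /-- `Nt` is the time derivative of `N`, and `N (0) = N₀`. -/
  intervalIntegrable : ∀ ω : ℝ, 0 < ω → IntervalIntegrable (fun t => Nt t ω) volume 0 T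
  eq_add_integral : ∀ ω : ℝ, 0 < ω → ∀ t ∈ Icc (0 : ℝ) T,
    N t ω = N₀ ω + ∫ s in (0 : ℝ)..t, Nt s ω
  /-- `∂ₜ N ∈ L^∞(0, T; L^∞(0, ∞))`. -/
  memLp_timeDeriv : MemLp (Function.uncurry Nt) ∞ ((timeInterval T).prod halfLine)
  /-- `D ∂ₜ N ∈ L^1(0, T; L^{2 p₀}(0, ∞) ∩ L^∞(0, ∞))`. -/
  locallyAC_timeDeriv : ∀ᵐ t ∂(timeInterval T), LocallyAC (Nt t)
  lintegral_D_timeDeriv_lt_top :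
    ∫⁻ t, (eLpNorm (D (Nt t)) ((2 * p₀ : ℕ) : ℝ≥0∞) halfLine + eLpNorm (D (Nt t)) ∞ halfLine)
      ∂(timeInterval T) < ∞
  /-- The equation holds almost everywhere. -/
  equation : ∀ᵐ z ∂((timeInterval T).prod halfLine),
    Nt z.1 z.2 = collision β (N z.1) z.2

/-- The kernel `1_{[-1/3, 0]}(u) |u|^{-(β+1)} + 1_{[0, 1]}(u) |u|^{2β}`. -/
def kernel (β u : ℝ) : ℝ :=
  (Icc (-1 / 3 : ℝ) 0).indicator (fun u => |u| ^ (-(β + 1))) u +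
    (Icc (0 : ℝ) 1).indicator (fun u => |u| ^ (2 * β)) u

/-- `∫₀^T ∫₀^∞ ∫_{-1/3}^1 |DN(ω) - DN(ω(1+u))|² kernel(u) du dω dt`. -/
def roughness (β T : ℝ) (N : ℝ → ℝ → ℝ) : ℝ≥0∞ :=
  ∫⁻ t in Ioo 0 T, ∫⁻ ω in Ioi (0 : ℝ), ∫⁻ u in Ioo (-1 / 3 : ℝ) 1,
    ENNReal.ofReal (|D (N t) ω - D (N t) (ω * (1 + u))| ^ 2 * kernel β u)

/-- The quantity controlled by the nonlinear smoothing, for the exponent `p`. -/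
def smoothing (β : ℝ) (p : ℕ) (T : ℝ) (N : ℝ → ℝ → ℝ) : ℝ≥0∞ :=
  (∫⁻ t in Ioo 0 T, ∫⁻ ω in Ioi (0 : ℝ), ∫⁻ u in Ioo (0 : ℝ) 1,
    ENNReal.ofReal (|D (N t) ω - D (N t) (ω * (1 + u))| ^ 2 * u ^ (2 * β) *
      ∫ θ in (0 : ℝ)..1,
        |θ * D (N t) ω + (1 - θ) * D (N t) (ω * (1 + u))| ^ (2 * (p - 1)))) +
  ∫⁻ t in Ioo 0 T, ∫⁻ ω in Ioi (0 : ℝ), ∫⁻ u in Ioo (0 : ℝ) (1 / 3),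
    ENNReal.ofReal (|D (N t) ω - D (N t) (ω * (1 - u))| ^ 2 * u ^ (-(β + 1)) *
      ∫ θ in (0 : ℝ)..1,
        |θ * D (N t) ω + (1 - θ) * D (N t) (ω * (1 - u))| ^ (2 * (p - 1)))

/-- The square `[F]_β²` of the fractional Sobolev type seminorm. -/
def seminormSq (β : ℝ) (F : ℝ → ℝ) : ℝ≥0∞ :=
  (∫⁻ ω in Ioi (0 : ℝ), ∫⁻ ω' in Ioi (0 : ℝ),
    ENNReal.ofReal ((Icc (2 / 3 : ℝ) (3 / 2)).indicator 1 (ω' / ω) *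
      (|F ω - F ω'| ^ 2 / |ω' - ω| ^ (β + 1)) * (ω * ω') ^ (β / 2))) +
  ∫⁻ ω in Ioi (0 : ℝ), ∫⁻ ω' in Ioi (0 : ℝ),
    ENNReal.ofReal ((Icc (1 / 2 : ℝ) 2).indicator 1 (ω' / ω) *
      (|F ω - F ω'| ^ 2 / |ω' - ω| ^ (-2 * β)) * (ω * ω') ^ (-(2 * β + 1) / 2))

end KineticMMT

end

noncomputable section

namespace KineticMMT

/-! ### Powers and logarithms near one -/

/-! The constants may depend on `N₀`, so it suffices to have one reference solution `M` with finite
roughness, provided that every other solution coincides with it on a short time interval. If no such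
solution exists, the claim is vacuous. Otherwise `M` moves at bounded speed (`exists_abs_sub_le`),
so it stays nonnegative up to a time fixed by `inf N₀` and that speed. Uniqueness
(`IsStrongSolution.ae_eq`) then identifies all solutions with `M` there. The three bounds follow:
the `X` norm is that of `M`; the smoothing functional is at most a power of the sup norm of `D M`
times the roughness (`lintegral_segment_le`); the fractional seminorm is at most a constant times
the roughness (`exists_seminormSq_le`).

The substance is uniqueness, in the sup norm, although the linearized operator is unbounded there.
With `W = N - M` and `|W| ≤ m`, the linearization is split by where `W` is evaluated. Terms in which
`W` is not differenced gain powers of `u` from the logarithmic Lipschitz bound on `N`, and cost a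
constant times `m`. Terms in which `W ω` itself is differenced have a good sign, because their
coefficients are products of two values of `M ≥ 0`; they cost a multiple of `m - W ω`. In the
remaining cross terms the two arguments differ by a substitution `u ↦ u + O(u ^ 3)`, and a change of
variables moves the difference onto the kernel (`exists_cross_bound`). Cutting off `u < δ` gives
`exists_collision_sub_le`: the difference of collision terms is at most `Λ * (m - W ω) + C * m + η`,
where `C` is independent of `η` and only `Λ` may blow up.

A large `Λ` is harmless: `comparison_step` turns a bound with amplitude `A` into the same bound with
amplitude `A * r`, `r < 1`. Iteration at fixed `η` removes `A`, and then `η` tends to zero. -/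

/-- Mean value inequality on a compact interval away from zero. The interval `[1/3, 3]` is wide
enough for `1 + u`, `1 + u + u ^ 2`, `v u 0` and the ratios `ψ u / u` that occur later. -/
theorem exists_rpow_bound (e : ℝ) : ∃ K : ℝ, 1 ≤ K ∧ ∀ x ∈ Icc (1 / 3 : ℝ) 3,
    x ^ e ≤ K ∧ ∀ y ∈ Icc (1 / 3 : ℝ) 3, |x ^ e - y ^ e| ≤ K * |x - y| := by
  have hc : ∀ e' : ℝ, ContinuousOn (fun x : ℝ => x ^ e') (Icc (1 / 3 : ℝ) 3) := fun e' x hx =>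
    (Real.continuousAt_rpow_const x e' (Or.inl (by linarith [hx.1]))).continuousWithinAt
  obtain ⟨K₁, h₁⟩ := isCompact_Icc.exists_bound_of_continuousOn (hc e)
  obtain ⟨K₂, h₂⟩ := isCompact_Icc.exists_bound_of_continuousOn
    ((hc (e - 1)).const_smul e)
  refine ⟨max 1 (max K₁ K₂), le_max_left _ _, fun x hx => ⟨?_, fun y hy => ?_⟩⟩
  · exact ((le_abs_self _).trans (h₁ x hx)).trans ((le_max_left _ _).trans (le_max_right _ _))
  · have := (convex_Icc (1 / 3 : ℝ) 3).norm_image_sub_le_of_norm_hasDerivWithin_le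
      (f := fun x : ℝ => x ^ e) (f' := fun x : ℝ => e * x ^ (e - 1)) (C := K₂)
      (fun z hz => (Real.hasDerivAt_rpow_const (Or.inl (by linarith [hz.1]))).hasDerivWithinAt)
      (fun z hz => by simpa using h₂ z hz) hy hx
    simp only [Real.norm_eq_abs] at this
    exact this.trans (mul_le_mul_of_nonneg_right ((le_max_right _ _).trans (le_max_right _ _))
      (abs_nonneg _))

theorem abs_log_le {r : ℝ} (hr : 1 / 3 ≤ r) : |Real.log r| ≤ 3 * |r - 1| := by
  have h0 : 0 < r := by linarith
  rw [abs_le]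
  have h1 := Real.log_le_sub_one_of_pos h0
  have h2 := Real.one_sub_inv_le_log_of_pos h0
  have h3 : 1 - r⁻¹ = (r - 1) * r⁻¹ := by field_simp
  have h4 : r⁻¹ ≤ 3 := by
    rw [inv_le_comm₀ h0 (by norm_num)]; linarith
  have h5 : |(r - 1) * r⁻¹| ≤ 3 * |r - 1| := by
    rw [abs_mul, abs_of_pos (inv_pos.2 h0), mul_comm]
    exact mul_le_mul_of_nonneg_right h4 (abs_nonneg _)
  constructor
  · linarith [neg_abs_le ((r - 1) * r⁻¹)]
  · linarith [le_abs_self (r - 1), abs_nonneg (r - 1)]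

/-! ### The logarithmic Lipschitz class -/

/-- Functions on `(0, ∞)` that are bounded and Lipschitz in the logarithmic variable. -/
structure LogLip (B : ℝ) (f : ℝ → ℝ) : Prop where
  bound : ∀ x, 0 < x → |f x| ≤ B
  lip : ∀ x y, 0 < x → 0 < y → |f x - f y| ≤ B * |Real.log x - Real.log y|

namespace LogLip

variable {B : ℝ} {f : ℝ → ℝ}

theorem nonneg (h : LogLip B f) : 0 ≤ B := (abs_nonneg _).trans (h.bound 1 one_pos)

theorem mono {B' : ℝ} (h : LogLip B f) (hB : B ≤ B') : LogLip B' f :=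
  ⟨fun x hx => (h.bound x hx).trans hB, fun x y hx hy =>
    (h.lip x y hx hy).trans (mul_le_mul_of_nonneg_right hB (abs_nonneg _))⟩

theorem continuousOn (h : LogLip B f) : ContinuousOn f (Ioi 0) := by
  intro x hx
  have h0 : (0 : ℝ) < x := hx
  rw [ContinuousWithinAt, tendsto_iff_dist_tendsto_zero]
  have h1 : ContinuousWithinAt (fun y => B * |Real.log y - Real.log x|) (Ioi 0) x :=
    (((Real.continuousAt_log h0.ne').sub continuousAt_const).abs.const_mul B).continuousWithinAt
  have h2 : Filter.Tendsto (fun y => B * |Real.log y - Real.log x|) (nhdsWithin x (Ioi 0))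
      (nhds 0) := by simpa [ContinuousWithinAt] using h1
  refine squeeze_zero' (Filter.Eventually.of_forall fun _ => dist_nonneg) ?_ h2
  filter_upwards [self_mem_nhdsWithin] with y hy
  rw [Real.dist_eq]
  exact h.lip y x hy h0

theorem sub_le_of_ratio (h : LogLip B f) {x y : ℝ} (hx : 0 < x) (hy : 0 < y)
    (hr : 1 / 3 ≤ x / y) : |f x - f y| ≤ 3 * B * |x / y - 1| := by
  refine (h.lip x y hx hy).trans ?_
  rw [← Real.log_div hx.ne' hy.ne', mul_comm 3 B, mul_assoc]
  exact mul_le_mul_of_nonneg_left (abs_log_le hr) h.nonneg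

end LogLip

/-! ### The weights -/

/-- The weight `(∏ᵢ vᵢ)^(-β - 1/2) (1 + u + u²)⁻¹ vₖ^(2β - 1/2)`. -/
def weight (β u : ℝ) (k : Fin 4) : ℝ :=
  (∏ i, v u i) ^ (-β - 1 / 2) / (1 + u + u ^ 2) * v u k ^ (2 * β - 1 / 2)

theorem v_zero (u : ℝ) : v u 0 = (1 + u) / (1 + u + u ^ 2) := rfl
theorem v_one (u : ℝ) : v u 1 = 1 := rfl
theorem v_two (u : ℝ) : v u 2 = u * (1 + u) / (1 + u + u ^ 2) := rfl
theorem v_three (u : ℝ) : v u 3 = u / (1 + u + u ^ 2) := rfl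

theorem v_pos {u : ℝ} (hu : 0 < u) (i : Fin 4) : 0 < v u i := by
  fin_cases i <;> simp only [v] <;> simp <;> positivity

theorem weight_nonneg {u : ℝ} (β : ℝ) (hu : 0 < u) (k : Fin 4) : 0 ≤ weight β u k := by
  have h1 : 0 < ∏ i, v u i := Finset.prod_pos fun i _ => v_pos hu i
  have h2 := v_pos hu k
  unfold weight
  positivity

/-- The regular factor of the weight of index `2`. -/
def regTwo (β u : ℝ) : ℝ := (1 + u) ^ (-(3 / 2) : ℝ) * (1 + u + u ^ 2) ^ (β + 1)

/-- The regular factor of the weight of index `3`. -/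
def regThree (β u : ℝ) : ℝ := (1 + u) ^ (-2 * β - 1) * (1 + u + u ^ 2) ^ (β + 1)

theorem prefactor_eq {u : ℝ} (β : ℝ) (hu : 0 < u) :
    (∏ i, v u i) ^ (-β - 1 / 2) / (1 + u + u ^ 2) =
      u ^ (-2 * β - 1) * (1 + u) ^ (-2 * β - 1) * (1 + u + u ^ 2) ^ (3 * β + 1 / 2) := by
  have hS : 0 < 1 + u + u ^ 2 := by positivity
  have h1 : 0 < 1 + u := by positivity
  have : ∏ i, v u i = u ^ (2 : ℝ) * (1 + u) ^ (2 : ℝ) * (1 + u + u ^ 2) ^ (-3 : ℝ) := by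
    rw [Fin.prod_univ_four, v_zero, v_one, v_two, v_three, Real.rpow_neg hS.le]
    norm_cast
    field_simp
  rw [this, Real.mul_rpow (by positivity) (by positivity),
    Real.mul_rpow (by positivity) (by positivity), ← Real.rpow_mul hu.le, ← Real.rpow_mul h1.le,
    ← Real.rpow_mul hS.le, mul_div_assoc, ← Real.rpow_sub_one hS.ne']
  ring_nf

/-- The power of `u` is `(-2β - 1) + (2β - 1/2) = -3/2`, independent of `β`. All dependence on `β`
sits in a factor that is smooth up to `u = 0`, as the change of variables in the cross terms
requires. -/
theorem weight_three {u : ℝ} (β : ℝ) (hu : 0 < u) :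
    weight β u 3 = u ^ (-(3 / 2) : ℝ) * regThree β u := by
  have hS : 0 < 1 + u + u ^ 2 := by positivity
  have h1 : 0 < 1 + u := by positivity
  rw [weight, prefactor_eq β hu, v_three, Real.div_rpow hu.le hS.le, regThree,
    div_eq_mul_inv (u ^ _), ← Real.rpow_neg hS.le]
  have e1 : u ^ (-(3 / 2) : ℝ) = u ^ (-2 * β - 1) * u ^ (2 * β - 1 / 2) := by
    rw [← Real.rpow_add hu]; ring_nf
  have e2 : (1 + u + u ^ 2) ^ (β + 1) =
      (1 + u + u ^ 2) ^ (3 * β + 1 / 2) * (1 + u + u ^ 2) ^ (-(2 * β - 1 / 2)) := by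
    rw [← Real.rpow_add hS]; ring_nf
  rw [e1, e2]; ring

theorem weight_two {u : ℝ} (β : ℝ) (hu : 0 < u) :
    weight β u 2 = u ^ (-(3 / 2) : ℝ) * regTwo β u := by
  have hS : 0 < 1 + u + u ^ 2 := by positivity
  have h1 : 0 < 1 + u := by positivity
  have h : weight β u 2 = weight β u 3 * (1 + u) ^ (2 * β - 1 / 2) := by
    have : v u 2 = v u 3 * (1 + u) := by rw [v_two, v_three]; ring
    rw [weight, weight, this, Real.mul_rpow (v_pos hu 3).le h1.le]; ring
  have e1 : (1 + u) ^ (-(3 / 2) : ℝ) = (1 + u) ^ (-2 * β - 1) * (1 + u) ^ (2 * β - 1 / 2) := by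
    rw [← Real.rpow_add h1]; ring_nf
  rw [h, weight_three β hu, regTwo, regThree, e1]; ring

/-- The regular factors are bounded and Lipschitz. -/
theorem exists_reg_bound (β : ℝ) : ∃ R : ℝ, 0 ≤ R ∧ ∀ x ∈ Ioc (0 : ℝ) 1,
    (|regTwo β x| ≤ R ∧ ∀ y ∈ Ioc (0 : ℝ) 1, |regTwo β x - regTwo β y| ≤ R * |x - y|) ∧
    (|regThree β x| ≤ R ∧ ∀ y ∈ Ioc (0 : ℝ) 1, |regThree β x - regThree β y| ≤ R * |x - y|) := by
  have key : ∀ d e : ℝ, ∃ R : ℝ, 0 ≤ R ∧ ∀ x ∈ Ioc (0 : ℝ) 1,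
      |(1 + x) ^ d * (1 + x + x ^ 2) ^ e| ≤ R ∧ ∀ y ∈ Ioc (0 : ℝ) 1,
      |(1 + x) ^ d * (1 + x + x ^ 2) ^ e - (1 + y) ^ d * (1 + y + y ^ 2) ^ e| ≤ R * |x - y| := by
    intro d e
    obtain ⟨K, hK1, hK⟩ := exists_rpow_bound d
    obtain ⟨L, hL1, hL⟩ := exists_rpow_bound e
    refine ⟨4 * (K * L), by positivity, fun x hx => ?_⟩
    have m1 : ∀ x ∈ Ioc (0 : ℝ) 1, 1 + x ∈ Icc (1 / 3 : ℝ) 3 := fun x hx =>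
      ⟨by linarith [hx.1], by linarith [hx.2]⟩
    have m2 : ∀ x ∈ Ioc (0 : ℝ) 1, 1 + x + x ^ 2 ∈ Icc (1 / 3 : ℝ) 3 := fun x hx =>
      ⟨by nlinarith [hx.1], by nlinarith [hx.1, hx.2]⟩
    have p1 : ∀ x ∈ Ioc (0 : ℝ) 1, 0 < (1 + x) ^ d := fun x hx =>
      Real.rpow_pos_of_pos (by linarith [hx.1]) _
    have p2 : ∀ x ∈ Ioc (0 : ℝ) 1, 0 < (1 + x + x ^ 2) ^ e := fun x hx =>
      Real.rpow_pos_of_pos (by nlinarith [hx.1]) _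
    constructor
    · rw [abs_of_pos (mul_pos (p1 x hx) (p2 x hx))]
      have := mul_le_mul (hK _ (m1 x hx)).1 (hL _ (m2 x hx)).1 (p2 x hx).le (by linarith)
      nlinarith
    · intro y hy
      have a1 := (hK _ (m1 x hx)).2 _ (m1 y hy)
      have a2 := (hL _ (m2 x hx)).2 _ (m2 y hy)
      have b1 : |1 + x - (1 + y)| = |x - y| := by ring_nf
      have b2 : |1 + x + x ^ 2 - (1 + y + y ^ 2)| ≤ 3 * |x - y| := by
        have : 1 + x + x ^ 2 - (1 + y + y ^ 2) = (1 + x + y) * (x - y) := by ring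
        rw [this, abs_mul, abs_of_pos (by linarith [hx.1, hy.1] : 0 < 1 + x + y)]
        exact mul_le_mul_of_nonneg_right (by linarith [hx.2, hy.2]) (abs_nonneg _)
      rw [b1] at a1
      have e1 : (1 + x) ^ d * (1 + x + x ^ 2) ^ e - (1 + y) ^ d * (1 + y + y ^ 2) ^ e =
        ((1 + x) ^ d - (1 + y) ^ d) * (1 + x + x ^ 2) ^ e +
          (1 + y) ^ d * ((1 + x + x ^ 2) ^ e - (1 + y + y ^ 2) ^ e) := by ring
      rw [e1]
      refine (abs_add_le _ _).trans ?_
      rw [abs_mul, abs_mul, abs_of_pos (p2 x hx), abs_of_pos (p1 y hy)]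
      have c1 := mul_le_mul a1 (hL _ (m2 x hx)).1 (p2 x hx).le (by positivity)
      have c2 := mul_le_mul (hK _ (m1 y hy)).1
        (a2.trans (mul_le_mul_of_nonneg_left b2 (by linarith))) (abs_nonneg _) (by linarith)
      nlinarith
  obtain ⟨R₁, h₁, H₁⟩ := key (-(3 / 2)) (β + 1)
  obtain ⟨R₂, h₂, H₂⟩ := key (-2 * β - 1) (β + 1)
  refine ⟨max R₁ R₂, le_max_of_le_left h₁, fun x hx => ⟨⟨?_, fun y hy => ?_⟩, ?_, fun y hy => ?_⟩⟩
  · exact (H₁ x hx).1.trans (le_max_left _ _)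
  · exact ((H₁ x hx).2 y hy).trans (mul_le_mul_of_nonneg_right (le_max_left _ _) (abs_nonneg _))
  · exact (H₂ x hx).1.trans (le_max_right _ _)
  · exact ((H₂ x hx).2 y hy).trans (mul_le_mul_of_nonneg_right (le_max_right _ _) (abs_nonneg _))

/-- The size of the weights and of the differences of powers of the `vᵢ`. -/
structure WeightBounds (β K u : ℝ) : Prop where
  one_le : 1 ≤ K
  zero : weight β u 0 ≤ K * u ^ (-2 * β - 1)
  one : weight β u 1 ≤ K * u ^ (-2 * β - 1)
  two : weight β u 2 ≤ K * u ^ (-(3 / 2) : ℝ)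
  three : weight β u 3 ≤ K * u ^ (-(3 / 2) : ℝ)
  near : |v u 0 ^ (2 * β + 3 / 2) - 1| ≤ K * u ^ (2 : ℝ)
  far₂ : v u 2 ^ (2 * β + 3 / 2) ≤ K * u ^ (2 * β + 3 / 2)
  far₃ : v u 3 ^ (2 * β + 3 / 2) ≤ K * u ^ (2 * β + 3 / 2)
  far_sub : |v u 3 ^ (2 * β + 3 / 2) - v u 2 ^ (2 * β + 3 / 2)| ≤ K * u ^ (2 * β + 5 / 2)

theorem v_zero_mem {u : ℝ} (hu : u ∈ Ioc (0 : ℝ) 1) : v u 0 ∈ Icc (1 / 3 : ℝ) 3 := by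
  obtain ⟨h0, h1⟩ := hu
  have hS : 0 < 1 + u + u ^ 2 := by positivity
  rw [v_zero]
  constructor
  · rw [le_div_iff₀ hS]; nlinarith
  · rw [div_le_iff₀ hS]; nlinarith

theorem abs_v_zero_sub_one_le {u : ℝ} (hu : 0 < u) : |v u 0 - 1| ≤ u ^ 2 := by
  have hS : 0 < 1 + u + u ^ 2 := by positivity
  have : v u 0 - 1 = -(u ^ 2 / (1 + u + u ^ 2)) := by rw [v_zero]; field_simp; ring
  rw [this, abs_neg, abs_of_pos (by positivity)]
  exact div_le_self (by positivity) (by nlinarith)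

/-- The gain in `near` comes from `v u 0 - 1 = O(u ^ 2)`. The extra power of `u` in `far_sub` comes
from `v u 2 = (1 + u) * v u 3`. -/
theorem exists_weightBounds (β : ℝ) : ∃ K : ℝ, ∀ u ∈ Ioc (0 : ℝ) 1, WeightBounds β K u := by
  obtain ⟨K₁, h₁, H₁⟩ := exists_rpow_bound (-2 * β - 1)
  obtain ⟨K₂, h₂, H₂⟩ := exists_rpow_bound (3 * β + 1 / 2)
  obtain ⟨K₃, h₃, H₃⟩ := exists_rpow_bound (2 * β - 1 / 2)
  obtain ⟨K₄, h₄, H₄⟩ := exists_rpow_bound (2 * β + 3 / 2)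
  obtain ⟨K₅, h₅, H₅⟩ := exists_rpow_bound (-(2 * β + 3 / 2))
  obtain ⟨R, hR, HR⟩ := exists_reg_bound β
  refine ⟨K₁ * K₂ * K₃ + R + K₄ * K₅, fun u hu => ?_⟩
  obtain ⟨hu0, hu1⟩ := hu
  have hS : 0 < 1 + u + u ^ 2 := by positivity
  have hu' : 0 < 1 + u := by positivity
  have m1 : 1 + u ∈ Icc (1 / 3 : ℝ) 3 := ⟨by linarith, by linarith⟩
  have m2 : 1 + u + u ^ 2 ∈ Icc (1 / 3 : ℝ) 3 := ⟨by nlinarith, by nlinarith⟩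
  have m0 : (1 : ℝ) ∈ Icc (1 / 3 : ℝ) 3 := by norm_num
  have m3 := v_zero_mem ⟨hu0, hu1⟩
  have hP : 1 ≤ K₁ * K₂ := one_le_mul_of_one_le_of_one_le h₁ h₂
  have hP3 : K₁ * K₂ ≤ K₁ * K₂ * K₃ := le_mul_of_one_le_right (by linarith) h₃
  have hP45 : 1 ≤ K₄ * K₅ := one_le_mul_of_one_le_of_one_le h₄ h₅
  set K := K₁ * K₂ * K₃ + R + K₄ * K₅ with hK
  have pre : (∏ i, v u i) ^ (-β - 1 / 2) / (1 + u + u ^ 2) ≤ K₁ * K₂ * u ^ (-2 * β - 1) := by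
    rw [prefactor_eq β hu0, mul_assoc, mul_comm]
    refine mul_le_mul_of_nonneg_right ?_ (by positivity)
    exact mul_le_mul (H₁ _ m1).1 (H₂ _ m2).1 (by positivity) (by linarith)
  have pre0 : 0 ≤ (∏ i, v u i) ^ (-β - 1 / 2) / (1 + u + u ^ 2) := by
    have h1 : 0 < ∏ i, v u i := Finset.prod_pos fun i _ => v_pos hu0 i
    positivity
  have e2 : v u 2 ^ (2 * β + 3 / 2) = u ^ (2 * β + 3 / 2) * ((1 + u) ^ (2 * β + 3 / 2) *
      (1 + u + u ^ 2) ^ (-(2 * β + 3 / 2))) := by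
    rw [v_two, Real.div_rpow (by positivity) hS.le, Real.mul_rpow hu0.le hu'.le,
      Real.rpow_neg hS.le]; ring
  have e3 : v u 3 ^ (2 * β + 3 / 2) = u ^ (2 * β + 3 / 2) *
      (1 + u + u ^ 2) ^ (-(2 * β + 3 / 2)) := by
    rw [v_three, Real.div_rpow (by positivity) hS.le, Real.rpow_neg hS.le]; ring
  refine ⟨by linarith, ?_, ?_, ?_, ?_, ?_, ?_, ?_, ?_⟩
  · rw [weight]
    have := mul_le_mul pre (H₃ _ m3).1 (Real.rpow_nonneg (v_pos hu0 0).le _) (by positivity)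
    refine this.trans ?_
    rw [mul_right_comm]
    exact mul_le_mul_of_nonneg_right (by linarith) (by positivity)
  · rw [weight, v_one, Real.one_rpow, mul_one]
    exact pre.trans (mul_le_mul_of_nonneg_right (by linarith) (by positivity))
  · rw [weight_two β hu0, mul_comm]
    refine mul_le_mul_of_nonneg_right ?_ (by positivity)
    linarith [le_abs_self (regTwo β u), (HR u ⟨hu0, hu1⟩).1.1]
  · rw [weight_three β hu0, mul_comm]
    refine mul_le_mul_of_nonneg_right ?_ (by positivity)
    linarith [le_abs_self (regThree β u), (HR u ⟨hu0, hu1⟩).2.1]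
  · have h := (H₄ _ m3).2 1 m0
    rw [Real.one_rpow] at h
    refine h.trans ?_
    rw [Real.rpow_two]
    refine mul_le_mul ?_ (abs_v_zero_sub_one_le hu0) (abs_nonneg _) (by linarith)
    have : K₄ ≤ K₄ * K₅ := le_mul_of_one_le_right (by linarith) h₅
    linarith
  · rw [e2, mul_comm]
    refine mul_le_mul_of_nonneg_right ?_ (by positivity)
    exact (mul_le_mul (H₄ _ m1).1 (H₅ _ m2).1 (by positivity) (by linarith)).trans (by linarith)
  · rw [e3, mul_comm]
    refine mul_le_mul_of_nonneg_right ?_ (by positivity)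
    have : K₅ ≤ K₄ * K₅ := le_mul_of_one_le_left (by linarith) h₄
    exact (H₅ _ m2).1.trans (by linarith)
  · have h := (H₄ _ m0).2 _ m1
    rw [Real.one_rpow] at h
    have e : |1 - (1 + u)| = u := by rw [show 1 - (1 + u) = -u by ring, abs_neg, abs_of_pos hu0]
    rw [e] at h
    have e5 : u ^ (2 * β + 5 / 2) = u ^ (2 * β + 3 / 2) * u := by
      rw [← Real.rpow_add_one hu0.ne']; ring_nf
    have : v u 3 ^ (2 * β + 3 / 2) - v u 2 ^ (2 * β + 3 / 2) = u ^ (2 * β + 3 / 2) *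
        ((1 - (1 + u) ^ (2 * β + 3 / 2)) * (1 + u + u ^ 2) ^ (-(2 * β + 3 / 2))) := by
      rw [e2, e3]; ring
    rw [this, e5, abs_mul, abs_mul, abs_of_pos (by positivity : 0 < u ^ (2 * β + 3 / 2)),
      abs_of_pos (by positivity : 0 < (1 + u + u ^ 2) ^ (-(2 * β + 3 / 2))), mul_left_comm K]
    refine mul_le_mul_of_nonneg_left ?_ (by positivity)
    refine (mul_le_mul h (H₅ _ m2).1 (by positivity) (by positivity)).trans ?_
    rw [mul_right_comm]
    exact mul_le_mul_of_nonneg_right (by linarith) hu0.le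

end KineticMMT
end

noncomputable section

namespace KineticMMT

/-! ### A cancellation by change of variables -/

/-- Near-identity substitutions `ψ(u) = u + O(u³)` of the interval `(0, 1]`. -/
structure NearIdentity (ψ ψ' : ℝ → ℝ) : Prop where
  hasDerivAt : ∀ u ∈ Ioc (0 : ℝ) 1, HasDerivAt ψ (ψ' u) u
  continuousOn : ContinuousOn ψ' (Ioc 0 1)
  half_le : ∀ u ∈ Ioc (0 : ℝ) 1, u / 2 ≤ ψ u
  le_self : ∀ u ∈ Ioc (0 : ℝ) 1, ψ u ≤ u
  sub_le : ∀ u ∈ Ioc (0 : ℝ) 1, u - u ^ 3 ≤ ψ u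
  deriv_sub_le : ∀ u ∈ Ioc (0 : ℝ) 1, |ψ' u - 1| ≤ 6 * u ^ 2

/-- A function bounded by `R` and Lipschitz with constant `R` on `(0, 1]`. -/
structure BddLip (R : ℝ) (ρ : ℝ → ℝ) : Prop where
  bound : ∀ x ∈ Ioc (0 : ℝ) 1, |ρ x| ≤ R
  lip : ∀ x ∈ Ioc (0 : ℝ) 1, ∀ y ∈ Ioc (0 : ℝ) 1, |ρ x - ρ y| ≤ R * |x - y|

theorem BddLip.nonneg {R : ℝ} {ρ : ℝ → ℝ} (h : BddLip R ρ) : 0 ≤ R :=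
  (abs_nonneg _).trans (h.bound 1 (by norm_num))

theorem BddLip.continuousOn {R : ℝ} {ρ : ℝ → ℝ} (h : BddLip R ρ) : ContinuousOn ρ (Ioc 0 1) := by
  have : LipschitzOnWith ⟨R, h.nonneg⟩ ρ (Ioc 0 1) :=
    LipschitzOnWith.of_dist_le_mul fun x hx y hy => by
      rw [Real.dist_eq, Real.dist_eq]; exact h.lip x hx y hy
  exact this.continuousOn

theorem BddLip.mul {R R' : ℝ} {ρ ρ' : ℝ → ℝ} (h : BddLip R ρ) (h' : BddLip R' ρ') :
    BddLip (2 * (R * R')) (fun x => ρ x * ρ' x) := by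
  have n1 := h.nonneg
  have n2 := h'.nonneg
  have nn := mul_nonneg n1 n2
  refine ⟨fun x hx => ?_, fun x hx y hy => ?_⟩
  · rw [abs_mul]
    have := mul_le_mul (h.bound x hx) (h'.bound x hx) (abs_nonneg _) n1
    linarith
  · have e : ρ x * ρ' x - ρ y * ρ' y = (ρ x - ρ y) * ρ' x + ρ y * (ρ' x - ρ' y) := by ring
    rw [e]
    refine (abs_add_le _ _).trans ?_
    rw [abs_mul, abs_mul]
    have a1 := mul_le_mul (h.lip x hx y hy) (h'.bound x hx) (abs_nonneg _)
      (mul_nonneg n1 (abs_nonneg _))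
    have a2 := mul_le_mul (h.bound y hy) (h'.lip x hx y hy) (abs_nonneg _) n1
    nlinarith

/-- Here `x` stands for `(ψ u / u) ^ (-3/2)`, so the difference is the kernel pulled back with its
Jacobian, minus the kernel. Each of the three factors changes by `O(u ^ 2)`, which outweighs `u ^
(-3/2)`. -/
theorem abs_jacobian_sub_le {K R u x ψ' ρ₁ ρ₂ : ℝ} (hK : 1 ≤ K) (hu : 0 < u) (hu1 : u ≤ 1)
    (hx0 : 0 ≤ x) (hx : x ≤ K) (hx1 : |x - 1| ≤ K * u ^ 2) (hψ : |ψ' - 1| ≤ 6 * u ^ 2)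
    (h1 : |ρ₁| ≤ R) (h12 : |ρ₁ - ρ₂| ≤ R * u ^ 3) :
    |u ^ (-(3 / 2) : ℝ) * x * ρ₁ * ψ' - u ^ (-(3 / 2) : ℝ) * ρ₂| ≤ 8 * K * R := by
  have hR : 0 ≤ R := (abs_nonneg _).trans h1
  have e : u ^ (-(3 / 2) : ℝ) * x * ρ₁ * ψ' - u ^ (-(3 / 2) : ℝ) * ρ₂ =
      u ^ (-(3 / 2) : ℝ) * (x * ρ₁ * (ψ' - 1) + (x - 1) * ρ₁ + (ρ₁ - ρ₂)) := by ring
  have b1 : |x * ρ₁ * (ψ' - 1)| ≤ K * R * (6 * u ^ 2) := by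
    rw [abs_mul, abs_mul, abs_of_nonneg hx0]
    exact mul_le_mul (mul_le_mul hx h1 (abs_nonneg _) (by linarith)) hψ (abs_nonneg _)
      (by positivity)
  have b2 : |(x - 1) * ρ₁| ≤ K * u ^ 2 * R := by
    rw [abs_mul]; exact mul_le_mul hx1 h1 (abs_nonneg _) (by positivity)
  have b3 : |ρ₁ - ρ₂| ≤ K * R * u ^ 2 := by
    refine h12.trans ?_
    have h3 : u ^ 3 ≤ u ^ 2 := pow_le_pow_of_le_one hu.le hu1 (by norm_num)
    calc R * u ^ 3 ≤ R * u ^ 2 := mul_le_mul_of_nonneg_left h3 hR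
      _ ≤ K * (R * u ^ 2) := le_mul_of_one_le_left (by positivity) hK
      _ = K * R * u ^ 2 := by ring
  have b4 : |x * ρ₁ * (ψ' - 1) + (x - 1) * ρ₁ + (ρ₁ - ρ₂)| ≤ 8 * K * R * u ^ (2 : ℝ) := by
    rw [Real.rpow_two]
    refine (abs_add_le _ _).trans ((add_le_add (abs_add_le _ _) le_rfl).trans ?_)
    linarith
  rw [e, abs_mul, abs_of_pos (by positivity : 0 < u ^ (-(3 / 2) : ℝ))]
  calc u ^ (-(3 / 2) : ℝ) * _ ≤ u ^ (-(3 / 2) : ℝ) * (8 * K * R * u ^ (2 : ℝ)) :=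
        mul_le_mul_of_nonneg_left b4 (by positivity)
    _ = 8 * K * R * (u ^ (-(3 / 2) : ℝ) * u ^ (2 : ℝ)) := by ring
    _ = 8 * K * R * u ^ (1 / 2 : ℝ) := by rw [← Real.rpow_add hu]; norm_num
    _ ≤ 8 * K * R * 1 := mul_le_mul_of_nonneg_left
        (Real.rpow_le_one hu.le hu1 (by norm_num)) (by positivity)
    _ = _ := mul_one _

/-- No regularity of `g` enters the bound: substituting `x = ψ u` in the term with `g (ψ u)`
replaces the difference of `g` by a difference of kernels, plus two boundary pieces. The constant is
uniform in the cutoff `δ`. -/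
theorem exists_cross_bound : ∃ C : ℝ, 0 ≤ C ∧ ∀ (R m δ : ℝ) (ρ g ψ ψ' : ℝ → ℝ), 0 < δ → δ ≤ 1 →
    BddLip R ρ → ContinuousOn g (Ioc 0 1) → (∀ u ∈ Ioc (0 : ℝ) 1, |g u| ≤ m) →
    NearIdentity ψ ψ' →
    |∫ u in δ..1, u ^ (-(3 / 2) : ℝ) * ρ u * (g u - g (ψ u))| ≤ C * (R * m) := by
  obtain ⟨K, hK1, hK⟩ := exists_rpow_bound (-(3 / 2))
  refine ⟨10 * K, by positivity, fun R m δ ρ g ψ ψ' hδ hδ1 hρ hg hgm hψ => ?_⟩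
  have hR := hρ.nonneg
  have hm : 0 ≤ m := (abs_nonneg _).trans (hgm 1 (by norm_num))
  have hRm : 0 ≤ R * m := mul_nonneg hR hm
  have hδm : δ ∈ Ioc (0 : ℝ) 1 := ⟨hδ, hδ1⟩
  have h1m : (1 : ℝ) ∈ Ioc (0 : ℝ) 1 := by norm_num
  have hψm : ∀ u ∈ Ioc (0 : ℝ) 1, ψ u ∈ Ioc (0 : ℝ) 1 := fun u hu =>
    ⟨by linarith [hψ.half_le u hu, hu.1], (hψ.le_self u hu).trans hu.2⟩
  have hψc : ContinuousOn ψ (Ioc 0 1) := fun u hu =>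
    (hψ.hasDerivAt u hu).continuousAt.continuousWithinAt
  set h : ℝ → ℝ := fun x => x ^ (-(3 / 2) : ℝ) * ρ x with hh
  have hhc : ContinuousOn h (Ioc 0 1) := by
    refine ContinuousOn.mul (fun x hx => ?_) hρ.continuousOn
    exact (Real.continuousAt_rpow_const x _ (Or.inl hx.1.ne')).continuousWithinAt
  have hgψ : ContinuousOn (fun u => g (ψ u)) (Ioc 0 1) := hg.comp hψc hψm
  have hhψ : ContinuousOn (fun u => h (ψ u)) (Ioc 0 1) := hhc.comp hψc hψm
  have hii : ∀ {F : ℝ → ℝ} {a b : ℝ}, ContinuousOn F (Ioc 0 1) → a ∈ Ioc (0 : ℝ) 1 →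
      b ∈ Ioc (0 : ℝ) 1 → IntervalIntegrable F volume a b := fun hF ha hb =>
    (hF.mono (ordConnected_Ioc.uIcc_subset ha hb)).intervalIntegrable
  have hhg : ContinuousOn (fun u => h u * g u) (Ioc 0 1) := hhc.mul hg
  have hhgψ : ContinuousOn (fun u => h u * g (ψ u)) (Ioc 0 1) := hhc.mul hgψ
  have hhgψ' : ContinuousOn (fun u => h (ψ u) * g (ψ u) * ψ' u) (Ioc 0 1) :=
    (hhψ.mul hgψ).mul hψ.continuousOn
  -- substitution
  have sub : ∫ u in δ..1, h (ψ u) * g (ψ u) * ψ' u = ∫ x in ψ δ..ψ 1, h x * g x := by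
    have huI : uIcc δ 1 ⊆ Ioc 0 1 := ordConnected_Ioc.uIcc_subset hδm h1m
    refine intervalIntegral.integral_comp_mul_deriv' (f := ψ) (f' := ψ') (g := fun x => h x * g x)
      (fun x hx => hψ.hasDerivAt x (huI hx)) (hψ.continuousOn.mono huI) (hhg.mono ?_)
    rintro _ ⟨x, hx, rfl⟩
    exact hψm x (huI hx)
  have split : ∫ u in δ..1, h u * g u = (∫ u in δ..ψ δ, h u * g u) +
      (∫ u in ψ δ..ψ 1, h u * g u) + ∫ u in ψ 1..1, h u * g u := by
    rw [intervalIntegral.integral_add_adjacent_intervals (hii hhg hδm (hψm δ hδm))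
      (hii hhg (hψm δ hδm) (hψm 1 h1m)),
      intervalIntegral.integral_add_adjacent_intervals (hii hhg hδm (hψm 1 h1m))
      (hii hhg (hψm 1 h1m) h1m)]
  -- The term `h (ψ u) * g (ψ u) * ψ' u` is added and subtracted; by the substitution its integral
  -- cancels that of `h * g` over `[ψ δ, ψ 1]`.
  have expand : ∫ u in δ..1, u ^ (-(3 / 2) : ℝ) * ρ u * (g u - g (ψ u)) =
      (∫ u in δ..ψ δ, h u * g u) + (∫ u in ψ 1..1, h u * g u) +
      ∫ u in δ..1, (h (ψ u) * ψ' u - h u) * g (ψ u) := by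
    have e1 : ∫ u in δ..1, u ^ (-(3 / 2) : ℝ) * ρ u * (g u - g (ψ u)) =
        (∫ u in δ..1, h u * g u) - ∫ u in δ..1, h u * g (ψ u) := by
      rw [← intervalIntegral.integral_sub (hii hhg hδm h1m) (hii hhgψ hδm h1m)]
      refine intervalIntegral.integral_congr fun u _ => ?_
      simp only [hh]; ring
    have e2 : ∫ u in δ..1, (h (ψ u) * ψ' u - h u) * g (ψ u) =
        (∫ u in δ..1, h (ψ u) * g (ψ u) * ψ' u) - ∫ u in δ..1, h u * g (ψ u) := by
      rw [← intervalIntegral.integral_sub (hii hhgψ' hδm h1m)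
        (hii hhgψ hδm h1m)]
      refine intervalIntegral.integral_congr fun u _ => ?_
      ring
    rw [e1, e2, sub, split]; ring
  -- the boundary terms
  have edge : ∀ {x y : ℝ}, x ∈ Ioc (0 : ℝ) 1 → y ∈ Ioc (0 : ℝ) 1 → y / 2 ≤ x → x ≤ y →
      |h x * g x| ≤ y ^ (-(3 / 2) : ℝ) * K * (R * m) := by
    intro x y hx hy h1 h2
    have hr : x / y ∈ Icc (1 / 3 : ℝ) 3 := by
      constructor
      · rw [le_div_iff₀ hy.1]; linarith [hy.1]
      · rw [div_le_iff₀ hy.1]; linarith [hy.1]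
    have e : x ^ (-(3 / 2) : ℝ) = y ^ (-(3 / 2) : ℝ) * (x / y) ^ (-(3 / 2) : ℝ) := by
      rw [← Real.mul_rpow hy.1.le (div_pos hx.1 hy.1).le, mul_div_cancel₀ _ hy.1.ne']
    have hy' := hy.1
    have hx' := hx.1
    rw [abs_mul, hh, abs_mul, mul_assoc, abs_of_pos (by positivity : 0 < x ^ (-(3 / 2) : ℝ)), e]
    refine mul_le_mul (mul_le_mul_of_nonneg_left (hK _ hr).1 (by positivity))
      (mul_le_mul (hρ.bound x hx) (hgm x hx) (abs_nonneg _) hR) (by positivity) (by positivity)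
  -- The interval between `ψ δ` and `δ` has length at most `δ ^ 3`, which beats the kernel size `δ ^
  -- (-3/2)`.
  have B1 : |∫ u in δ..ψ δ, h u * g u| ≤ K * (R * m) := by
    have hb := hψ.le_self δ hδm
    have ha := hψ.half_le δ hδm
    have hc := hψ.sub_le δ hδm
    have := intervalIntegral.norm_integral_le_of_norm_le_const (a := δ) (b := ψ δ)
      (f := fun u => h u * g u) (C := δ ^ (-(3 / 2) : ℝ) * K * (R * m)) (fun x hx => by
        rw [uIoc_of_ge hb] at hx
        exact edge ⟨by linarith [hx.1], by linarith [hx.2]⟩ hδm (by linarith [hx.1]) hx.2)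
    refine this.trans ?_
    rw [abs_of_nonpos (by linarith)]
    calc δ ^ (-(3 / 2) : ℝ) * K * (R * m) * -(ψ δ - δ)
        ≤ δ ^ (-(3 / 2) : ℝ) * K * (R * m) * δ ^ (3 : ℝ) := by
          refine mul_le_mul_of_nonneg_left ?_ (by positivity)
          norm_cast; linarith
      _ = K * (R * m) * (δ ^ (-(3 / 2) : ℝ) * δ ^ (3 : ℝ)) := by ring
      _ = K * (R * m) * δ ^ (3 / 2 : ℝ) := by rw [← Real.rpow_add hδ]; norm_num
      _ ≤ K * (R * m) * 1 := mul_le_mul_of_nonneg_left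
          (Real.rpow_le_one hδ.le hδ1 (by norm_num)) (by positivity)
      _ = _ := mul_one _
  have B2 : |∫ u in ψ 1..1, h u * g u| ≤ K * (R * m) := by
    have hb := hψ.le_self 1 h1m
    have ha := hψ.half_le 1 h1m
    have := intervalIntegral.norm_integral_le_of_norm_le_const (a := ψ 1) (b := 1)
      (f := fun u => h u * g u) (C := 1 ^ (-(3 / 2) : ℝ) * K * (R * m)) (fun x hx => by
        rw [uIoc_of_le hb] at hx
        exact edge ⟨by linarith [hx.1], by linarith [hx.2]⟩ h1m (by linarith [hx.1]) hx.2)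
    refine this.trans ?_
    rw [abs_of_nonneg (by linarith), Real.one_rpow, one_mul]
    exact mul_le_of_le_one_right (by positivity) (by linarith)
  have B3 : |∫ u in δ..1, (h (ψ u) * ψ' u - h u) * g (ψ u)| ≤ 8 * K * R * m := by
    have := intervalIntegral.norm_integral_le_of_norm_le_const (a := δ) (b := 1)
      (f := fun u => (h (ψ u) * ψ' u - h u) * g (ψ u)) (C := 8 * K * R * m) (fun u hu => by
        rw [uIoc_of_le hδ1] at hu
        have hu' : u ∈ Ioc (0 : ℝ) 1 := ⟨hδ.trans hu.1, hu.2⟩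
        have hu0 := hu'.1
        have hp := hψm u hu'
        have hr : ψ u / u ∈ Icc (1 / 3 : ℝ) 3 := by
          constructor
          · rw [le_div_iff₀ hu0]; linarith [hψ.half_le u hu']
          · rw [div_le_iff₀ hu0]; linarith [hψ.le_self u hu']
        have e : (ψ u) ^ (-(3 / 2) : ℝ) = u ^ (-(3 / 2) : ℝ) * (ψ u / u) ^ (-(3 / 2) : ℝ) := by
          rw [← Real.mul_rpow hu0.le (div_pos hp.1 hu0).le, mul_div_cancel₀ _ hu0.ne']
        have hd : |ψ u - u| ≤ u ^ 3 := by
          rw [abs_le]; constructor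
          · linarith [hψ.sub_le u hu']
          · have := pow_pos hu0 3
            linarith [hψ.le_self u hu']
        rw [Real.norm_eq_abs, abs_mul]
        refine mul_le_mul ?_ (hgm _ hp) (abs_nonneg _) (by positivity)
        simp only [hh]
        rw [e]
        refine abs_jacobian_sub_le hK1 hu0 hu'.2 (Real.rpow_nonneg (div_pos hp.1 hu0).le _)
          (hK _ hr).1 ?_ (hψ.deriv_sub_le u hu') (hρ.bound _ hp) ?_
        · have := (hK _ hr).2 1 (by norm_num)
          rw [Real.one_rpow] at this
          refine this.trans (mul_le_mul_of_nonneg_left ?_ (by linarith))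
          have e3 : ψ u / u - 1 = (ψ u - u) / u := by field_simp
          rw [e3, abs_div, abs_of_pos hu0, div_le_iff₀ hu0]
          linarith [hd, (by ring : u ^ 2 * u = u ^ 3)]
        · exact (hρ.lip _ hp _ hu').trans (mul_le_mul_of_nonneg_left hd hR))
    refine this.trans ?_
    rw [abs_of_nonneg (by linarith)]
    exact mul_le_of_le_one_right (by positivity) (by linarith)
  rw [expand]
  refine (abs_add_le _ _).trans ((add_le_add (abs_add_le _ _) le_rfl).trans ?_)
  linarith

/-! ### The two substitutions that occur -/

/-- This is `ψ = v · 2`. At `k = 2` the cross term compares `W (ω / u)` with `W (ω / ψ u)`. -/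
theorem nearIdentity_v_two : NearIdentity (fun u => u * (1 + u) / (1 + u + u ^ 2))
    (fun u => (1 + 2 * u) / (1 + u + u ^ 2) ^ 2) := by
  have hS : ∀ u ∈ Ioc (0 : ℝ) 1, 0 < 1 + u + u ^ 2 := fun u hu => by nlinarith [hu.1]
  refine ⟨fun u hu => ?_, ?_, fun u hu => ?_, fun u hu => ?_, fun u hu => ?_, fun u hu => ?_⟩
  · have h1 : HasDerivAt (fun u : ℝ => u * (1 + u)) (1 * (1 + u) + u * 1) u :=
      (hasDerivAt_id' u).fun_mul ((hasDerivAt_id' u).const_add 1)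
    have h2 : HasDerivAt (fun u : ℝ => 1 + u + u ^ 2) (1 + 2 * u) u := by
      simpa using ((hasDerivAt_id' u).const_add 1).fun_add (hasDerivAt_pow 2 u)
    exact (h1.fun_div h2 (hS u hu).ne').congr_deriv (by ring)
  · refine ContinuousOn.div (by fun_prop) (by fun_prop) fun u hu => (pow_pos (hS u hu) 2).ne'
  · rw [le_div_iff₀ (hS u hu)]
    nlinarith [hu.1, hu.2, mul_pos hu.1 hu.1, mul_pos hu.1 (mul_pos hu.1 hu.1),
      mul_nonneg hu.1.le (sub_nonneg.2 hu.2),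
      mul_nonneg (mul_pos hu.1 hu.1).le (sub_nonneg.2 hu.2)]
  · rw [div_le_iff₀ (hS u hu)]
    nlinarith [mul_pos hu.1 (mul_pos hu.1 hu.1)]
  · rw [le_div_iff₀ (hS u hu)]
    have := pow_pos hu.1 4
    have := pow_pos hu.1 5
    nlinarith
  · have h := hS u hu
    have h0 := hu.1
    have e : (1 + 2 * u) / (1 + u + u ^ 2) ^ 2 - 1 =
        -(u ^ 2 * (3 + 2 * u + u ^ 2) / (1 + u + u ^ 2) ^ 2) := by field_simp; ring
    rw [e, abs_neg, abs_of_pos (by positivity), div_le_iff₀ (by positivity)]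
    have : 3 + 2 * u + u ^ 2 ≤ 6 * (1 + u + u ^ 2) ^ 2 := by
      nlinarith [pow_pos h0 2, pow_pos h0 3, pow_pos h0 4]
    nlinarith [pow_pos h0 2]

/-- At `k = 3` the cross term compares `W` at `ω * (1 + 1 / u)` and at `ω * (1 + u + 1 / u)`; the
second is the first with `1 / u` replaced by `1 / ψ u = u + 1 / u`. -/
theorem nearIdentity_inv : NearIdentity (fun u => u / (1 + u ^ 2))
    (fun u => (1 - u ^ 2) / (1 + u ^ 2) ^ 2) := by
  have hS : ∀ u : ℝ, 0 < 1 + u ^ 2 := fun u => by positivity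
  refine ⟨fun u hu => ?_, ?_, fun u hu => ?_, fun u hu => ?_, fun u hu => ?_, fun u hu => ?_⟩
  · have h2 : HasDerivAt (fun u : ℝ => 1 + u ^ 2) (2 * u) u := by
      simpa using (hasDerivAt_pow 2 u).const_add 1
    exact ((hasDerivAt_id' u).fun_div h2 (hS u).ne').congr_deriv (by ring)
  · refine ContinuousOn.div (by fun_prop) (by fun_prop) fun u hu => (pow_pos (hS u) 2).ne'
  · rw [le_div_iff₀ (hS u)]
    nlinarith [hu.1, hu.2, mul_nonneg hu.1.le (sub_nonneg.2 hu.2),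
      mul_nonneg (mul_pos hu.1 hu.1).le (sub_nonneg.2 hu.2)]
  · rw [div_le_iff₀ (hS u)]
    nlinarith [mul_pos hu.1 (mul_pos hu.1 hu.1)]
  · rw [le_div_iff₀ (hS u)]
    have := pow_pos hu.1 5
    nlinarith
  · have h0 := hu.1
    have e : (1 - u ^ 2) / (1 + u ^ 2) ^ 2 - 1 =
        -(u ^ 2 * (3 + u ^ 2) / (1 + u ^ 2) ^ 2) := by field_simp; ring
    rw [e, abs_neg, abs_of_pos (by positivity), div_le_iff₀ (by positivity)]
    have : 3 + u ^ 2 ≤ 6 * (1 + u ^ 2) ^ 2 := by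
      nlinarith [pow_pos h0 2, pow_pos h0 4]
    nlinarith [pow_pos h0 2]

end KineticMMT
end

noncomputable section

namespace KineticMMT

/-! ### Pointwise structure of the collision integrand -/

/-- The integrand of the collision operator. -/
def collisionIntegrand (β : ℝ) (f : ℝ → ℝ) (ω u : ℝ) : ℝ :=
  (∏ i, v u i) ^ (-β - 1 / 2) / (1 + u + u ^ 2) *
    ∑ j : Fin 4, ∑ k : Fin 4, (-1 : ℝ) ^ ((j : ℕ) + (k : ℕ)) *
      v u j ^ (2 * β + 3 / 2) * v u k ^ (2 * β - 1 / 2) *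
      ∏ i ∈ Finset.univ.erase j, f (ω * v u i / v u k)

/-- The difference of `f` over the pair of frequencies with indices `0, 1`. -/
def nearDiff (β : ℝ) (f : ℝ → ℝ) (ω u : ℝ) (k : Fin 4) : ℝ :=
  f (ω * v u 0 / v u k) - v u 0 ^ (2 * β + 3 / 2) * f (ω * v u 1 / v u k)

/-- The difference of `f` over the pair of frequencies with indices `2, 3`. -/
def farDiff (β : ℝ) (f : ℝ → ℝ) (ω u : ℝ) (k : Fin 4) : ℝ :=
  v u 3 ^ (2 * β + 3 / 2) * f (ω * v u 2 / v u k) -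
    v u 2 ^ (2 * β + 3 / 2) * f (ω * v u 3 / v u k)

/-- The part of the collision integrand with a fixed index `k`. -/
def cluster (β : ℝ) (f : ℝ → ℝ) (ω u : ℝ) (k : Fin 4) : ℝ :=
  f (ω * v u 2 / v u k) * f (ω * v u 3 / v u k) * nearDiff β f ω u k +
    f (ω * v u 0 / v u k) * f (ω * v u 1 / v u k) * farDiff β f ω u k

/-- For fixed `k`, the terms `j = 0, 1` share the factor with indices `2, 3`, and the terms `j = 2,
3` share the factor with indices `0, 1`. The alternating signs turn each pair into a difference. -/
theorem collisionIntegrand_eq (β : ℝ) (f : ℝ → ℝ) (ω u : ℝ) :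
    collisionIntegrand β f ω u = -(weight β u 0 * cluster β f ω u 0) +
      weight β u 1 * cluster β f ω u 1 - weight β u 2 * cluster β f ω u 2 +
      weight β u 3 * cluster β f ω u 3 := by
  have h0 : (Finset.univ.erase 0 : Finset (Fin 4)) = {1, 2, 3} := by decide
  have h1 : (Finset.univ.erase 1 : Finset (Fin 4)) = {0, 2, 3} := by decide
  have h2 : (Finset.univ.erase 2 : Finset (Fin 4)) = {0, 1, 3} := by decide
  have h3 : (Finset.univ.erase 3 : Finset (Fin 4)) = {0, 1, 2} := by decide
  have p : ∀ (a b c : Fin 4) (g : Fin 4 → ℝ), a ≠ b → a ≠ c → b ≠ c →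
      ∏ i ∈ ({a, b, c} : Finset (Fin 4)), g i = g a * (g b * g c) := by
    intro a b c g hab hac hbc
    rw [Finset.prod_insert (by simp [hab, hac]), Finset.prod_insert (by simp [hbc]),
      Finset.prod_singleton]
  have hv : v u 1 ^ (2 * β + 3 / 2) = 1 := by rw [v_one, Real.one_rpow]
  simp only [collisionIntegrand, weight, cluster, nearDiff, farDiff, Fin.sum_univ_four, h0, h1, h2,
    h3]
  rw [show ((0 : Fin 4) : ℕ) = 0 from rfl, show ((1 : Fin 4) : ℕ) = 1 from rfl,
    show ((2 : Fin 4) : ℕ) = 2 from rfl, show ((3 : Fin 4) : ℕ) = 3 from rfl]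
  simp only [p 1 2 3 _ (by decide) (by decide) (by decide),
    p 0 2 3 _ (by decide) (by decide) (by decide), p 0 1 3 _ (by decide) (by decide) (by decide),
    p 0 1 2 _ (by decide) (by decide) (by decide), hv]
  ring

theorem collision_eq (β : ℝ) (f : ℝ → ℝ) (ω : ℝ) :
    collision β f ω = ∫ u in (0 : ℝ)..1, collisionIntegrand β f ω u := rfl

/-! ### Linearization -/

/-- The linearization of `cluster` along `W = N - M`. -/
def linCluster (β : ℝ) (M N W : ℝ → ℝ) (ω u : ℝ) (k : Fin 4) : ℝ :=
  M (ω * v u 2 / v u k) * M (ω * v u 3 / v u k) * nearDiff β W ω u k +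
    nearDiff β N ω u k * (N (ω * v u 2 / v u k) * W (ω * v u 3 / v u k) +
      W (ω * v u 2 / v u k) * M (ω * v u 3 / v u k)) +
    M (ω * v u 0 / v u k) * M (ω * v u 1 / v u k) * farDiff β W ω u k +
    farDiff β N ω u k * (N (ω * v u 0 / v u k) * W (ω * v u 1 / v u k) +
      W (ω * v u 0 / v u k) * M (ω * v u 1 / v u k))

/-- The telescoping order is chosen so that differences of `W` are multiplied by values of `M` only.
Hence nonnegativity of one of the two profiles suffices. -/
theorem cluster_sub (β : ℝ) (M N : ℝ → ℝ) (ω u : ℝ) (k : Fin 4) :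
    cluster β N ω u k - cluster β M ω u k = linCluster β M N (fun x => N x - M x) ω u k := by
  simp only [cluster, linCluster, nearDiff, farDiff]; ring

theorem linCluster_neg (β : ℝ) (M N W : ℝ → ℝ) (ω u : ℝ) (k : Fin 4) :
    linCluster β M N (fun x => -W x) ω u k = -linCluster β M N W ω u k := by
  simp only [linCluster, nearDiff, farDiff]; ring

/-- The linearization of `collisionIntegrand` along `W = N - M`. -/
def linIntegrand (β : ℝ) (M N W : ℝ → ℝ) (ω u : ℝ) : ℝ :=
  -(weight β u 0 * linCluster β M N W ω u 0) + weight β u 1 * linCluster β M N W ω u 1 -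
    weight β u 2 * linCluster β M N W ω u 2 + weight β u 3 * linCluster β M N W ω u 3

theorem collisionIntegrand_sub (β : ℝ) (M N : ℝ → ℝ) (ω u : ℝ) :
    collisionIntegrand β N ω u - collisionIntegrand β M ω u =
      linIntegrand β M N (fun x => N x - M x) ω u := by
  simp only [collisionIntegrand_eq, linIntegrand, ← cluster_sub]; ring

theorem linIntegrand_neg (β : ℝ) (M N W : ℝ → ℝ) (ω u : ℝ) :
    linIntegrand β M N (fun x => -W x) ω u = -linIntegrand β M N W ω u := by
  simp only [linIntegrand, linCluster_neg]; ring

/-! ### Pointwise bounds -/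

/-- The integrable function that dominates the collision integrand. -/
def majorant (β u : ℝ) : ℝ := u ^ (1 - 2 * β) + u ^ (1 / 2 : ℝ) + u ^ (2 * β + 1)

theorem majorant_nonneg (β : ℝ) {u : ℝ} (hu : 0 ≤ u) : 0 ≤ majorant β u := by
  unfold majorant; positivity

variable {β K B m u ω : ℝ} {f M N W : ℝ → ℝ}

/-- The two gains are those of `abs_nearDiff_le` and `abs_farDiff_le`. Against `u ^ (-2β - 1)` they
leave the exponents `1 - 2β` and `3/2`, against `u ^ (-3/2)` the exponents `1/2` and `2β + 1`. -/
theorem weight_mul_le (h : WeightBounds β K u) (hu : u ∈ Ioc (0 : ℝ) 1) (k : Fin 4) :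
    weight β u k * u ^ (2 : ℝ) ≤ K * majorant β u ∧
      weight β u k * u ^ (2 * β + 5 / 2) ≤ K * majorant β u := by
  obtain ⟨h0, h1⟩ := hu
  have hK : 0 ≤ K := by linarith [h.one_le]
  have n1 : 0 ≤ u ^ (1 - 2 * β) := by positivity
  have n2 : 0 ≤ u ^ (1 / 2 : ℝ) := by positivity
  have n3 : 0 ≤ u ^ (2 * β + 1) := by positivity
  have hle : u ^ (3 / 2 : ℝ) ≤ u ^ (1 / 2 : ℝ) :=
    Real.rpow_le_rpow_of_exponent_ge h0 h1 (by norm_num)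
  have key : ∀ c e : ℝ, ∀ p q : ℝ, c ≤ K * u ^ e → u ^ (e + p) ≤ majorant β u →
      u ^ (e + q) ≤ majorant β u → c * u ^ p ≤ K * majorant β u ∧ c * u ^ q ≤ K * majorant β u := by
    intro c e p q hc hp hq
    rw [Real.rpow_add h0] at hp hq
    have p1 : 0 ≤ u ^ p := by positivity
    have p2 : 0 ≤ u ^ q := by positivity
    constructor
    · calc c * u ^ p ≤ K * u ^ e * u ^ p := mul_le_mul_of_nonneg_right hc p1
        _ = K * (u ^ e * u ^ p) := by ring
        _ ≤ _ := mul_le_mul_of_nonneg_left hp hK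
    · calc c * u ^ q ≤ K * u ^ e * u ^ q := mul_le_mul_of_nonneg_right hc p2
        _ = K * (u ^ e * u ^ q) := by ring
        _ ≤ _ := mul_le_mul_of_nonneg_left hq hK
  have A : ∀ c, c ≤ K * u ^ (-2 * β - 1) → c * u ^ (2 : ℝ) ≤ K * majorant β u ∧
      c * u ^ (2 * β + 5 / 2) ≤ K * majorant β u := fun c hc => by
    refine key c _ _ _ hc ?_ ?_
    · rw [show -2 * β - 1 + 2 = 1 - 2 * β by ring]; unfold majorant; linarith
    · rw [show -2 * β - 1 + (2 * β + 5 / 2) = 3 / 2 by ring]; unfold majorant; linarith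
  have C : ∀ c, c ≤ K * u ^ (-(3 / 2) : ℝ) → c * u ^ (2 : ℝ) ≤ K * majorant β u ∧
      c * u ^ (2 * β + 5 / 2) ≤ K * majorant β u := fun c hc => by
    refine key c _ _ _ hc ?_ ?_
    · rw [show (-(3 / 2) + 2 : ℝ) = 1 / 2 by norm_num]; unfold majorant; linarith
    · rw [show -(3 / 2) + (2 * β + 5 / 2) = 2 * β + 1 by ring]; unfold majorant; linarith
  fin_cases k
  exacts [A _ h.zero, A _ h.one, C _ h.two, C _ h.three]

theorem weight_mul_far_le (h : WeightBounds β K u) (hu : u ∈ Ioc (0 : ℝ) 1) {k : Fin 4}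
    (hk : weight β u k ≤ K * u ^ (-2 * β - 1)) :
    weight β u k * u ^ (2 * β + 3 / 2) ≤ K * majorant β u := by
  obtain ⟨h0, h1⟩ := hu
  have hK : 0 ≤ K := by linarith [h.one_le]
  have n1 : 0 ≤ u ^ (1 - 2 * β) := by positivity
  have n3 : 0 ≤ u ^ (2 * β + 1) := by positivity
  calc weight β u k * u ^ (2 * β + 3 / 2) ≤ K * u ^ (-2 * β - 1) * u ^ (2 * β + 3 / 2) :=
        mul_le_mul_of_nonneg_right hk (by positivity)
    _ = K * u ^ (1 / 2 : ℝ) := by rw [mul_assoc, ← Real.rpow_add h0]; ring_nf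
    _ ≤ _ := mul_le_mul_of_nonneg_left (by unfold majorant; linarith) hK

/-- Both the ratio of the two frequencies and the coefficient are within `O(u ^ 2)` of one. -/
theorem abs_nearDiff_le (h : WeightBounds β K u) (hu : u ∈ Ioc (0 : ℝ) 1) (hω : 0 < ω)
    (hf : LogLip B f) (k : Fin 4) : |nearDiff β f ω u k| ≤ 4 * K * B * u ^ (2 : ℝ) := by
  have hp := fun i => v_pos hu.1 i
  have x0 : 0 < ω * v u 0 / v u k := div_pos (mul_pos hω (hp _)) (hp _)
  have x1 : 0 < ω * v u 1 / v u k := div_pos (mul_pos hω (hp _)) (hp _)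
  have hr : ω * v u 0 / v u k / (ω * v u 1 / v u k) = v u 0 := by
    have := (hp k).ne'
    rw [v_one]; field_simp
  have h1 := hf.sub_le_of_ratio x0 x1 (by rw [hr]; exact (v_zero_mem hu).1)
  rw [hr] at h1
  have h2 := abs_v_zero_sub_one_le hu.1
  rw [← Real.rpow_two] at h2
  have hB := hf.nonneg
  have e : nearDiff β f ω u k = (f (ω * v u 0 / v u k) - f (ω * v u 1 / v u k)) -
      (v u 0 ^ (2 * β + 3 / 2) - 1) * f (ω * v u 1 / v u k) := by rw [nearDiff]; ring
  have h3 : |(v u 0 ^ (2 * β + 3 / 2) - 1) * f (ω * v u 1 / v u k)| ≤ K * u ^ (2 : ℝ) * B := by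
    rw [abs_mul]
    exact mul_le_mul h.near (hf.bound _ x1) (abs_nonneg _)
      (mul_nonneg (by linarith [h.one_le]) (by have := hu.1; positivity))
  have h4 : 3 * B * |v u 0 - 1| ≤ K * (3 * B * u ^ (2 : ℝ)) :=
    (mul_le_mul_of_nonneg_left h2 (by positivity)).trans
      (le_mul_of_one_le_left (by have := hu.1; positivity) h.one_le)
  rw [e]
  refine (abs_sub _ _).trans ?_
  linarith

/-- The frequencies have ratio `1 + u`, so one power of `u` is gained over the size `u ^ (2β + 3/2)`
of the coefficients. -/
theorem abs_farDiff_le (h : WeightBounds β K u) (hu : u ∈ Ioc (0 : ℝ) 1) (hω : 0 < ω)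
    (hf : LogLip B f) (k : Fin 4) : |farDiff β f ω u k| ≤ 4 * K * B * u ^ (2 * β + 5 / 2) := by
  have hp := fun i => v_pos hu.1 i
  have hu0 := hu.1
  have x2 : 0 < ω * v u 2 / v u k := div_pos (mul_pos hω (hp _)) (hp _)
  have x3 : 0 < ω * v u 3 / v u k := div_pos (mul_pos hω (hp _)) (hp _)
  have hr : ω * v u 2 / v u k / (ω * v u 3 / v u k) = 1 + u := by
    have := (hp k).ne'
    have : 1 + u + u ^ 2 ≠ 0 := by positivity
    rw [v_two, v_three]; field_simp
  have h1 := hf.sub_le_of_ratio x2 x3 (by rw [hr]; linarith)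
  rw [hr, add_sub_cancel_left, abs_of_pos hu0] at h1
  have hB := hf.nonneg
  have hK : 0 ≤ K := by linarith [h.one_le]
  have e : farDiff β f ω u k =
      v u 3 ^ (2 * β + 3 / 2) * (f (ω * v u 2 / v u k) - f (ω * v u 3 / v u k)) +
      (v u 3 ^ (2 * β + 3 / 2) - v u 2 ^ (2 * β + 3 / 2)) * f (ω * v u 3 / v u k) := by
    rw [farDiff]; ring
  have e5 : u ^ (2 * β + 5 / 2) = u ^ (2 * β + 3 / 2) * u := by
    rw [← Real.rpow_add_one hu0.ne']; ring_nf
  have h3 := mul_le_mul h.far_sub (hf.bound _ x3) (abs_nonneg _) (by positivity)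
  have h4 := mul_le_mul h.far₃ h1 (abs_nonneg _) (by positivity)
  rw [e]
  refine (abs_add_le _ _).trans ?_
  rw [abs_mul, abs_mul, abs_of_pos (Real.rpow_pos_of_pos (hp 3) _)]
  rw [e5] at h3 ⊢
  linarith

theorem abs_collisionIntegrand_le (h : WeightBounds β K u) (hu : u ∈ Ioc (0 : ℝ) 1) (hω : 0 < ω)
    (hf : LogLip B f) : |collisionIntegrand β f ω u| ≤ 32 * K ^ 2 * B ^ 3 * majorant β u := by
  have hp := fun i => v_pos hu.1 i
  have hu0 := hu.1
  have hB := hf.nonneg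
  have hK : 0 ≤ K := by linarith [h.one_le]
  have key : ∀ k, |weight β u k * cluster β f ω u k| ≤ 8 * K ^ 2 * B ^ 3 * majorant β u := by
    intro k
    have hx : ∀ i, |f (ω * v u i / v u k)| ≤ B := fun i =>
      hf.bound _ (div_pos (mul_pos hω (hp _)) (hp _))
    have hxx : ∀ i j, |f (ω * v u i / v u k) * f (ω * v u j / v u k)| ≤ B * B := fun i j => by
      rw [abs_mul]; exact mul_le_mul (hx i) (hx j) (abs_nonneg _) hB
    have a1 := mul_le_mul (hxx 2 3) (abs_nearDiff_le h hu hω hf k) (abs_nonneg _) (by positivity)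
    have a2 := mul_le_mul (hxx 0 1) (abs_farDiff_le h hu hω hf k) (abs_nonneg _) (by positivity)
    obtain ⟨w1, w2⟩ := weight_mul_le h hu k
    have hw := weight_nonneg β hu0 k
    have a3 : |cluster β f ω u k| ≤ 4 * K * B ^ 3 * u ^ (2 : ℝ) +
        4 * K * B ^ 3 * u ^ (2 * β + 5 / 2) := by
      rw [cluster]
      refine (abs_add_le _ _).trans ?_
      rw [abs_mul _ (nearDiff β f ω u k), abs_mul _ (farDiff β f ω u k)]
      linarith
    rw [abs_mul, abs_of_nonneg hw]
    calc _ ≤ weight β u k * (4 * K * B ^ 3 * u ^ (2 : ℝ) + 4 * K * B ^ 3 * u ^ (2 * β + 5 / 2)) :=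
          mul_le_mul_of_nonneg_left a3 hw
      _ = 4 * K * B ^ 3 * (weight β u k * u ^ (2 : ℝ)) +
          4 * K * B ^ 3 * (weight β u k * u ^ (2 * β + 5 / 2)) := by ring
      _ ≤ 4 * K * B ^ 3 * (K * majorant β u) + 4 * K * B ^ 3 * (K * majorant β u) :=
          add_le_add (mul_le_mul_of_nonneg_left w1 (by positivity))
            (mul_le_mul_of_nonneg_left w2 (by positivity))
      _ = _ := by ring
  rw [collisionIntegrand_eq]
  have k0 := abs_le.1 (key 0)
  have k1 := abs_le.1 (key 1)
  have k2 := abs_le.1 (key 2)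
  have k3 := abs_le.1 (key 3)
  rw [abs_le]
  constructor <;> linarith [k0.1, k0.2, k1.1, k1.2, k2.1, k2.2, k3.1, k3.2]

/-! ### One-sided bounds for the linearization -/

/-- Hypotheses for the comparison of two profiles: `M` is nonnegative and `W` bounded by `m`. -/
structure Comparison (B m : ℝ) (M N W : ℝ → ℝ) : Prop where
  hM : LogLip B M
  hN : LogLip B N
  M_nonneg : ∀ x, 0 < x → 0 ≤ M x
  W_le : ∀ x, 0 < x → |W x| ≤ m

theorem Comparison.m_nonneg (h : Comparison B m M N W) : 0 ≤ m :=
  (abs_nonneg _).trans (h.W_le 1 one_pos)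

theorem Comparison.neg (h : Comparison B m M N W) : Comparison B m M N (fun x => -W x) :=
  ⟨h.hM, h.hN, h.M_nonneg, fun x hx => by rw [abs_neg]; exact h.W_le x hx⟩

theorem abs_mul_add_le {P n a b c d : ℝ} (hn : |n| ≤ P) (ha : |a| ≤ B) (hb : |b| ≤ m)
    (hc : |c| ≤ m) (hd : |d| ≤ B) : |n * (a * b + c * d)| ≤ P * (2 * B * m) := by
  have hB := (abs_nonneg _).trans ha
  have hm := (abs_nonneg _).trans hb
  rw [abs_mul]
  refine mul_le_mul hn ?_ (abs_nonneg _) ((abs_nonneg _).trans hn)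
  refine (abs_add_le _ _).trans ?_
  rw [abs_mul, abs_mul]
  have := mul_le_mul ha hb (abs_nonneg _) hB
  have := mul_le_mul hc hd (abs_nonneg _) hm
  linarith

/-- The part of `linCluster` in which `W` is differenced. -/
def mainCluster (β : ℝ) (M W : ℝ → ℝ) (ω u : ℝ) (k : Fin 4) : ℝ :=
  M (ω * v u 2 / v u k) * M (ω * v u 3 / v u k) * nearDiff β W ω u k +
    M (ω * v u 0 / v u k) * M (ω * v u 1 / v u k) * farDiff β W ω u k

/-- In the discarded terms the difference falls on `N`, which is logarithmically Lipschitz, while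
`W` enters only through its sup bound. -/
theorem abs_linCluster_sub_main_le (h : WeightBounds β K u) (hu : u ∈ Ioc (0 : ℝ) 1) (hω : 0 < ω)
    (hc : Comparison B m M N W) (k : Fin 4) :
    |linCluster β M N W ω u k - mainCluster β M W ω u k| ≤
      8 * K * B ^ 2 * m * (u ^ (2 : ℝ) + u ^ (2 * β + 5 / 2)) := by
  have hp := fun i => v_pos hu.1 i
  have hx : ∀ i, 0 < ω * v u i / v u k := fun i => div_pos (mul_pos hω (hp _)) (hp _)
  have a1 := abs_mul_add_le (abs_nearDiff_le h hu hω hc.hN k) (hc.hN.bound _ (hx 2))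
    (hc.W_le _ (hx 3)) (hc.W_le _ (hx 2)) (hc.hM.bound _ (hx 3))
  have a2 := abs_mul_add_le (abs_farDiff_le h hu hω hc.hN k) (hc.hN.bound _ (hx 0))
    (hc.W_le _ (hx 1)) (hc.W_le _ (hx 0)) (hc.hM.bound _ (hx 1))
  have e : ∀ a b c d : ℝ, a + b + c + d - (a + c) = b + d := fun a b c d => by ring
  rw [linCluster, mainCluster, e]
  refine (abs_add_le _ _).trans ?_
  linarith

theorem mul_le_of_le_add {p A x y : ℝ} (hp : 0 ≤ p) (hpA : p ≤ A) (hxy : x ≤ y) (hy : 0 ≤ y) :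
    p * x ≤ A * y :=
  (mul_le_mul_of_nonneg_left hxy hp).trans (mul_le_mul_of_nonneg_right hpA hy)

theorem Comparison.prod_bounds (hc : Comparison B m M N W) {x y : ℝ} (hx : 0 < x) (hy : 0 < y) :
    0 ≤ M x * M y ∧ M x * M y ≤ B ^ 2 := by
  have h1 := (le_abs_self _).trans (hc.hM.bound x hx)
  have h2 := (le_abs_self _).trans (hc.hM.bound y hy)
  refine ⟨mul_nonneg (hc.M_nonneg x hx) (hc.M_nonneg y hy), ?_⟩
  rw [sq]
  exact mul_le_mul h1 h2 (hc.M_nonneg y hy) hc.hM.nonneg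

theorem abs_far_main_le (h : WeightBounds β K u) (hu : u ∈ Ioc (0 : ℝ) 1) (hω : 0 < ω)
    (hc : Comparison B m M N W) (k : Fin 4) :
    |M (ω * v u 0 / v u k) * M (ω * v u 1 / v u k) * farDiff β W ω u k| ≤
      2 * K * B ^ 2 * m * u ^ (2 * β + 3 / 2) := by
  have hp := fun i => v_pos hu.1 i
  have hx : ∀ i, 0 < ω * v u i / v u k := fun i => div_pos (mul_pos hω (hp _)) (hp _)
  have hK : 0 ≤ K := by linarith [h.one_le]
  have hu0 := hu.1
  obtain ⟨q0, q1⟩ := hc.prod_bounds (hx 0) (hx 1)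
  have b3 := mul_le_mul h.far₃ (hc.W_le _ (hx 2)) (abs_nonneg _) (by positivity)
  have b2 := mul_le_mul h.far₂ (hc.W_le _ (hx 3)) (abs_nonneg _) (by positivity)
  have b : |farDiff β W ω u k| ≤ 2 * K * m * u ^ (2 * β + 3 / 2) := by
    rw [farDiff]
    refine (abs_sub _ _).trans ?_
    rw [abs_mul, abs_mul, abs_of_pos (Real.rpow_pos_of_pos (hp 3) _),
      abs_of_pos (Real.rpow_pos_of_pos (hp 2) _)]
    linarith
  rw [abs_mul, abs_of_nonneg q0]
  have := mul_le_mul q1 b (abs_nonneg _) (by positivity)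
  linarith

/-- At `k = 0` the frequency of index `0` is `ω` itself. With the sign carried by `k = 0`, replacing
the other value of `W` by its bound `m` leaves `m - W ω`, as in a maximum principle. -/
theorem nearDiff_zero_le (h : WeightBounds β K u) (hu : u ∈ Ioc (0 : ℝ) 1) (hω : 0 < ω)
    (hc : Comparison B m M N W) :
    -(M (ω * v u 2 / v u 0) * M (ω * v u 3 / v u 0) * nearDiff β W ω u 0) ≤
      B ^ 2 * ((m - W ω) + K * m * u ^ (2 : ℝ)) := by
  have hp := fun i => v_pos hu.1 i
  have hx : ∀ i, 0 < ω * v u i / v u 0 := fun i => div_pos (mul_pos hω (hp _)) (hp _)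
  have hm := hc.m_nonneg
  have hu0 := hu.1
  have hK : 0 ≤ K := by linarith [h.one_le]
  obtain ⟨q0, q1⟩ := hc.prod_bounds (hx 2) (hx 3)
  have hw := (le_abs_self _).trans (hc.W_le ω hω)
  rw [← mul_neg]
  refine mul_le_of_le_add q0 q1 ?_ (add_nonneg (by linarith) (by positivity))
  rw [nearDiff, mul_div_cancel_right₀ _ (hp 0).ne']
  have h1 := (le_abs_self _).trans (hc.W_le _ (hx 1))
  have h2 := mul_le_mul_of_nonneg_left h1 (Real.rpow_pos_of_pos (hp 0) (2 * β + 3 / 2)).le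
  have h3 := mul_le_mul_of_nonneg_right ((le_abs_self _).trans h.near) hm
  nlinarith

theorem nearDiff_one_le (h : WeightBounds β K u) (hu : u ∈ Ioc (0 : ℝ) 1) (hω : 0 < ω)
    (hc : Comparison B m M N W) :
    M (ω * v u 2 / v u 1) * M (ω * v u 3 / v u 1) * nearDiff β W ω u 1 ≤
      B ^ 2 * ((m - W ω) + K * m * u ^ (2 : ℝ)) := by
  have hp := fun i => v_pos hu.1 i
  have hx : ∀ i, 0 < ω * v u i / v u 1 := fun i => div_pos (mul_pos hω (hp _)) (hp _)
  have hm := hc.m_nonneg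
  have hu0 := hu.1
  have hK : 0 ≤ K := by linarith [h.one_le]
  obtain ⟨q0, q1⟩ := hc.prod_bounds (hx 2) (hx 3)
  have hw := (le_abs_self _).trans (hc.W_le ω hω)
  refine mul_le_of_le_add q0 q1 ?_ (add_nonneg (by linarith) (by positivity))
  rw [nearDiff, mul_div_cancel_right₀ _ (hp 1).ne']
  have h1 := (le_abs_self _).trans (hc.W_le _ (hx 0))
  have h3 : |(v u 0 ^ (2 * β + 3 / 2) - 1) * W ω| ≤ K * u ^ (2 : ℝ) * m := by
    rw [abs_mul]
    exact mul_le_mul h.near (hc.W_le ω hω) (abs_nonneg _) (by positivity)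
  linarith [(abs_le.1 h3).1]

/-- The same sign mechanism for the pair `2, 3`, since index `2` now sits at `ω`. The mismatch of
the two coefficients is paid for by `far_sub`. -/
theorem farDiff_two_le (h : WeightBounds β K u) (hu : u ∈ Ioc (0 : ℝ) 1) (hω : 0 < ω)
    (hc : Comparison B m M N W) :
    -(M (ω * v u 0 / v u 2) * M (ω * v u 1 / v u 2) * farDiff β W ω u 2) ≤
      B ^ 2 * (K * u ^ (2 * β + 3 / 2) * (m - W ω) + K * m * u ^ (2 * β + 5 / 2)) := by
  have hp := fun i => v_pos hu.1 i
  have hx : ∀ i, 0 < ω * v u i / v u 2 := fun i => div_pos (mul_pos hω (hp _)) (hp _)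
  have hm := hc.m_nonneg
  have hu0 := hu.1
  have hK : 0 ≤ K := by linarith [h.one_le]
  obtain ⟨q0, q1⟩ := hc.prod_bounds (hx 0) (hx 1)
  have hw := (le_abs_self _).trans (hc.W_le ω hω)
  have hw' : 0 ≤ m - W ω := by linarith
  rw [← mul_neg]
  refine mul_le_of_le_add q0 q1 ?_ (by positivity)
  rw [farDiff, mul_div_cancel_right₀ _ (hp 2).ne']
  have h1 := (le_abs_self _).trans (hc.W_le _ (hx 3))
  have h2 := mul_le_mul_of_nonneg_left h1 (Real.rpow_pos_of_pos (hp 2) (2 * β + 3 / 2)).le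
  have h3 := mul_le_mul_of_nonneg_right (abs_le.1 h.far_sub).1 hm
  have h4 := mul_le_mul_of_nonneg_right h.far₃ hw'
  nlinarith

theorem farDiff_three_le (h : WeightBounds β K u) (hu : u ∈ Ioc (0 : ℝ) 1) (hω : 0 < ω)
    (hc : Comparison B m M N W) :
    M (ω * v u 0 / v u 3) * M (ω * v u 1 / v u 3) * farDiff β W ω u 3 ≤
      B ^ 2 * (K * u ^ (2 * β + 3 / 2) * (m - W ω) + K * m * u ^ (2 * β + 5 / 2)) := by
  have hp := fun i => v_pos hu.1 i
  have hx : ∀ i, 0 < ω * v u i / v u 3 := fun i => div_pos (mul_pos hω (hp _)) (hp _)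
  have hm := hc.m_nonneg
  have hu0 := hu.1
  have hK : 0 ≤ K := by linarith [h.one_le]
  obtain ⟨q0, q1⟩ := hc.prod_bounds (hx 0) (hx 1)
  have hw := (le_abs_self _).trans (hc.W_le ω hω)
  have hw' : 0 ≤ m - W ω := by linarith
  refine mul_le_of_le_add q0 q1 ?_ (by positivity)
  rw [farDiff, mul_div_cancel_right₀ _ (hp 3).ne']
  have h1 := (le_abs_self _).trans (hc.W_le _ (hx 2))
  have h2 := mul_le_mul_of_nonneg_left h1 (Real.rpow_pos_of_pos (hp 3) (2 * β + 3 / 2)).le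
  have h3 := mul_le_mul_of_nonneg_right (abs_le.1 h.far_sub).2 hm
  have h4 := mul_le_mul_of_nonneg_right h.far₂ hw'
  nlinarith

/-- The part of `linCluster` that is controlled only after integration in `u`. -/
def crossCluster (M W : ℝ → ℝ) (ω u : ℝ) (k : Fin 4) : ℝ :=
  M (ω * v u 2 / v u k) * M (ω * v u 3 / v u k) *
    (W (ω * v u 0 / v u k) - W (ω * v u 1 / v u k))

theorem abs_near_sub_cross_le (h : WeightBounds β K u) (hu : u ∈ Ioc (0 : ℝ) 1) (hω : 0 < ω)
    (hc : Comparison B m M N W) (k : Fin 4) :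
    |M (ω * v u 2 / v u k) * M (ω * v u 3 / v u k) * nearDiff β W ω u k -
      crossCluster M W ω u k| ≤ B ^ 2 * (K * m * u ^ (2 : ℝ)) := by
  have hp := fun i => v_pos hu.1 i
  have hx : ∀ i, 0 < ω * v u i / v u k := fun i => div_pos (mul_pos hω (hp _)) (hp _)
  have hu0 := hu.1
  have hK : 0 ≤ K := by linarith [h.one_le]
  obtain ⟨q0, q1⟩ := hc.prod_bounds (hx 2) (hx 3)
  have e : M (ω * v u 2 / v u k) * M (ω * v u 3 / v u k) * nearDiff β W ω u k -
      crossCluster M W ω u k = -(M (ω * v u 2 / v u k) * M (ω * v u 3 / v u k) *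
        ((v u 0 ^ (2 * β + 3 / 2) - 1) * W (ω * v u 1 / v u k))) := by
    rw [crossCluster, nearDiff]; ring
  have h3 : |(v u 0 ^ (2 * β + 3 / 2) - 1) * W (ω * v u 1 / v u k)| ≤ K * u ^ (2 : ℝ) * m := by
    rw [abs_mul]
    exact mul_le_mul h.near (hc.W_le _ (hx 1)) (abs_nonneg _) (by positivity)
  rw [e, abs_neg, abs_mul, abs_of_nonneg q0]
  refine mul_le_mul q1 (h3.trans (by linarith)) (abs_nonneg _) (by positivity)

/-- The coefficient of the damping term. -/
def damping (β u : ℝ) : ℝ := u ^ (-2 * β - 1) + u ^ (2 * β)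

theorem weight_mul_damped_le {w c Q d e₁ e₂ e₃ L : ℝ} (hw : 0 ≤ w) (hd : 0 ≤ d)
    (hm : 0 ≤ m) (hK : 0 ≤ K) (hQ : Q ≤ B ^ 2 * c * d + 19 * K * B ^ 2 * m * (e₁ + e₂ + e₃))
    (h1 : w * e₁ ≤ K * L) (h2 : w * e₂ ≤ K * L) (h3 : w * e₃ ≤ K * L) {D : ℝ}
    (hc : w * c ≤ K ^ 2 * D) :
    w * Q ≤ B ^ 2 * K ^ 2 * D * d + 57 * K ^ 2 * B ^ 2 * m * L := by
  calc w * Q ≤ w * (B ^ 2 * c * d + 19 * K * B ^ 2 * m * (e₁ + e₂ + e₃)) :=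
        mul_le_mul_of_nonneg_left hQ hw
    _ = B ^ 2 * (w * c * d) + 19 * K * B ^ 2 * m * (w * e₁ + w * e₂ + w * e₃) := by ring
    _ ≤ B ^ 2 * (K ^ 2 * D * d) + 19 * K * B ^ 2 * m * (K * L + K * L + K * L) :=
        add_le_add (mul_le_mul_of_nonneg_left (mul_le_mul_of_nonneg_right hc hd) (by positivity))
          (mul_le_mul_of_nonneg_left (by linarith) (by positivity))
    _ = _ := by ring

/-- Indices `0, 1` are damped through the near pair and their far pair is already integrable after
weighting. Indices `2, 3` are damped through the far pair, and their near pair is left as the cross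
term. Each index contributes `57`, whence `228`. -/
theorem linIntegrand_le (h : WeightBounds β K u) (hu : u ∈ Ioc (0 : ℝ) 1) (hω : 0 < ω)
    (hc : Comparison B m M N W) :
    linIntegrand β M N W ω u ≤
      (weight β u 3 * crossCluster M W ω u 3 - weight β u 2 * crossCluster M W ω u 2) +
      4 * B ^ 2 * K ^ 2 * damping β u * (m - W ω) + 228 * K ^ 2 * B ^ 2 * m * majorant β u := by
  have hu0 := hu.1
  have hm := hc.m_nonneg
  have hK1 := h.one_le
  have hK : 0 ≤ K := by linarith
  have hw' : 0 ≤ m - W ω := by linarith [(le_abs_self _).trans (hc.W_le ω hω)]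
  have L := fun k => abs_le.1 (abs_linCluster_sub_main_le h hu hω hc k)
  have F := fun k => abs_le.1 (abs_far_main_le h hu hω hc k)
  have X := fun k => abs_le.1 (abs_near_sub_cross_le h hu hω hc k)
  have hWn := fun k => weight_nonneg β hu0 k
  have hW := fun k => weight_mul_le h hu k
  have n2 : 0 ≤ u ^ (2 : ℝ) := by positivity
  have n3 : 0 ≤ u ^ (2 * β + 5 / 2) := by positivity
  have n4 : 0 ≤ u ^ (2 * β + 3 / 2) := by positivity
  have d1 : 0 ≤ u ^ (-2 * β - 1) := by positivity
  have d2 : 0 ≤ u ^ (2 * β) := by positivity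
  have Km : 0 ≤ K * B ^ 2 * m := by positivity
  have q2 := mul_nonneg Km n2
  have q3 := mul_nonneg Km n3
  have q4 := mul_nonneg Km n4
  have c01 : ∀ w, w ≤ K * u ^ (-2 * β - 1) → w * 1 ≤ K ^ 2 * damping β u := fun w hw => by
    rw [mul_one, damping]
    nlinarith [mul_nonneg hK d1, mul_nonneg (mul_nonneg hK hK) d2,
      mul_nonneg (sub_nonneg.2 hK1) (mul_nonneg hK d1)]
  have c23 : ∀ w, w ≤ K * u ^ (-(3 / 2) : ℝ) →
      w * (K * u ^ (2 * β + 3 / 2)) ≤ K ^ 2 * damping β u := fun w hw => by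
    calc w * (K * u ^ (2 * β + 3 / 2)) ≤ K * u ^ (-(3 / 2) : ℝ) * (K * u ^ (2 * β + 3 / 2)) :=
          mul_le_mul_of_nonneg_right hw (by positivity)
      _ = K ^ 2 * (u ^ (-(3 / 2) : ℝ) * u ^ (2 * β + 3 / 2)) := by ring
      _ = K ^ 2 * u ^ (2 * β) := by rw [← Real.rpow_add hu0]; ring_nf
      _ ≤ _ := mul_le_mul_of_nonneg_left (by rw [damping]; linarith) (by positivity)
  have T0 := weight_mul_damped_le (Q := -linCluster β M N W ω u 0) (c := 1) (B := B)
    (e₁ := u ^ (2 : ℝ)) (e₂ := u ^ (2 * β + 5 / 2)) (e₃ := u ^ (2 * β + 3 / 2)) (hWn 0) hw' hm hK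
    (by
      have := nearDiff_zero_le h hu hω hc
      have l := L 0
      rw [mainCluster] at l
      linarith [l.1, (F 0).1])
    (hW 0).1 (hW 0).2 (weight_mul_far_le h hu h.zero) (c01 _ h.zero)
  have T1 := weight_mul_damped_le (Q := linCluster β M N W ω u 1) (c := 1) (B := B)
    (e₁ := u ^ (2 : ℝ)) (e₂ := u ^ (2 * β + 5 / 2)) (e₃ := u ^ (2 * β + 3 / 2)) (hWn 1) hw' hm hK
    (by
      have := nearDiff_one_le h hu hω hc
      have l := L 1
      rw [mainCluster] at l
      linarith [l.2, (F 1).2])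
    (hW 1).1 (hW 1).2 (weight_mul_far_le h hu h.one) (c01 _ h.one)
  -- The slot `e₃` is empty here: the far difference goes entirely into the damping, with
  -- coefficient `c = K * u ^ (2β + 3/2)`.
  have T2 := weight_mul_damped_le (Q := -(linCluster β M N W ω u 2 - crossCluster M W ω u 2))
    (B := B) (e₁ := u ^ (2 : ℝ)) (e₂ := u ^ (2 * β + 5 / 2)) (e₃ := 0) (hWn 2) hw' hm hK
    (c := K * u ^ (2 * β + 3 / 2))
    (by
      have := farDiff_two_le h hu hω hc
      have l := L 2
      rw [mainCluster] at l
      linarith [l.1, (X 2).1])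
    (hW 2).1 (hW 2).2 (by rw [mul_zero]; exact mul_nonneg hK (majorant_nonneg β hu0.le))
    (c23 _ h.two)
  have T3 := weight_mul_damped_le (Q := linCluster β M N W ω u 3 - crossCluster M W ω u 3)
    (B := B) (e₁ := u ^ (2 : ℝ)) (e₂ := u ^ (2 * β + 5 / 2)) (e₃ := 0) (hWn 3) hw' hm hK
    (c := K * u ^ (2 * β + 3 / 2))
    (by
      have := farDiff_three_le h hu hω hc
      have l := L 3
      rw [mainCluster] at l
      linarith [l.2, (X 3).2])
    (hW 3).1 (hW 3).2 (by rw [mul_zero]; exact mul_nonneg hK (majorant_nonneg β hu0.le))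
    (c23 _ h.three)
  rw [linIntegrand]
  linarith

end KineticMMT
end

noncomputable section

namespace KineticMMT

/-! ### Continuity and integrability of the collision integrand -/

variable {β K B m ω : ℝ} {f M N W : ℝ → ℝ}

theorem continuousOn_v (i : Fin 4) : ContinuousOn (fun u => v u i) (Ioi 0) := by
  have hS : ∀ u ∈ Ioi (0 : ℝ), 1 + u + u ^ 2 ≠ 0 := fun u (hu : 0 < u) => by positivity
  fin_cases i
  · exact ContinuousOn.div (by fun_prop) (by fun_prop) hS
  · exact continuousOn_const
  · exact ContinuousOn.div (by fun_prop) (by fun_prop) hS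
  · exact ContinuousOn.div (by fun_prop) (by fun_prop) hS

theorem continuousOn_v_rpow (i : Fin 4) (e : ℝ) : ContinuousOn (fun u => v u i ^ e) (Ioi 0) :=
  (continuousOn_v i).rpow_const fun _ hu => Or.inl (v_pos hu i).ne'

theorem continuousOn_comp_v (hω : 0 < ω) (hf : ContinuousOn f (Ioi 0)) (i k : Fin 4) :
    ContinuousOn (fun u => f (ω * v u i / v u k)) (Ioi 0) :=
  hf.comp ((continuousOn_const.mul (continuousOn_v i)).div (continuousOn_v k)
    fun _ hu => (v_pos hu k).ne') fun _ hu => div_pos (mul_pos hω (v_pos hu i)) (v_pos hu k)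

theorem continuousOn_weight (β : ℝ) (k : Fin 4) :
    ContinuousOn (fun u => weight β u k) (Ioi 0) := by
  have hS : ∀ u ∈ Ioi (0 : ℝ), 1 + u + u ^ 2 ≠ 0 := fun u (hu : 0 < u) => by positivity
  refine ContinuousOn.mul (ContinuousOn.div ?_ (by fun_prop) hS) (continuousOn_v_rpow k _)
  exact (continuousOn_finsetProd _ fun i _ => continuousOn_v i).rpow_const
    fun u hu => Or.inl (Finset.prod_pos fun i _ => v_pos hu i).ne'

theorem continuousOn_nearDiff (hω : 0 < ω) (hf : ContinuousOn f (Ioi 0)) (k : Fin 4) :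
    ContinuousOn (fun u => nearDiff β f ω u k) (Ioi 0) :=
  (continuousOn_comp_v hω hf 0 k).sub
    ((continuousOn_v_rpow 0 _).mul (continuousOn_comp_v hω hf 1 k))

theorem continuousOn_farDiff (hω : 0 < ω) (hf : ContinuousOn f (Ioi 0)) (k : Fin 4) :
    ContinuousOn (fun u => farDiff β f ω u k) (Ioi 0) :=
  ((continuousOn_v_rpow 3 _).mul (continuousOn_comp_v hω hf 2 k)).sub
    ((continuousOn_v_rpow 2 _).mul (continuousOn_comp_v hω hf 3 k))

theorem continuousOn_collisionIntegrand (hω : 0 < ω) (hf : ContinuousOn f (Ioi 0)) :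
    ContinuousOn (collisionIntegrand β f ω) (Ioi 0) := by
  have hc : ∀ k, ContinuousOn (fun u => weight β u k * cluster β f ω u k) (Ioi 0) := fun k =>
    (continuousOn_weight β k).mul
      ((((continuousOn_comp_v hω hf 2 k).mul (continuousOn_comp_v hω hf 3 k)).mul
        (continuousOn_nearDiff hω hf k)).add
      (((continuousOn_comp_v hω hf 0 k).mul (continuousOn_comp_v hω hf 1 k)).mul
        (continuousOn_farDiff hω hf k)))
  refine ((((hc 0).neg.add (hc 1)).sub (hc 2)).add (hc 3)).congr fun u _ => ?_
  exact collisionIntegrand_eq β f ω u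

theorem continuousOn_crossCluster (hω : 0 < ω) (hM : ContinuousOn M (Ioi 0))
    (hW : ContinuousOn W (Ioi 0)) (k : Fin 4) :
    ContinuousOn (fun u => crossCluster M W ω u k) (Ioi 0) :=
  ((continuousOn_comp_v hω hM 2 k).mul (continuousOn_comp_v hω hM 3 k)).mul
    ((continuousOn_comp_v hω hW 0 k).sub (continuousOn_comp_v hω hW 1 k))

/-- The exponents `1 - 2β` and `2β + 1` both exceed `-1` exactly when `-1 < β < 1`. -/
theorem intervalIntegrable_majorant (hβ : β ∈ Ioo (-1 : ℝ) 1) (a b : ℝ) :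
    IntervalIntegrable (majorant β) volume a b :=
  ((intervalIntegral.intervalIntegrable_rpow' (by linarith [hβ.2])).add
    (intervalIntegral.intervalIntegrable_rpow' (by norm_num))).add
    (intervalIntegral.intervalIntegrable_rpow' (by linarith [hβ.1]))

theorem intervalIntegrable_of_Ioi {F : ℝ → ℝ} (hF : ContinuousOn F (Ioi 0)) {a b : ℝ} (ha : 0 < a)
    (hb : 0 < b) : IntervalIntegrable F volume a b :=
  (hF.mono (ordConnected_Ioi.uIcc_subset ha hb)).intervalIntegrable

theorem intervalIntegrable_collisionIntegrand (hβ : β ∈ Ioo (-1 : ℝ) 1)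
    (hK : ∀ u ∈ Ioc (0 : ℝ) 1, WeightBounds β K u) (hω : 0 < ω) (hf : LogLip B f) :
    IntervalIntegrable (collisionIntegrand β f ω) volume 0 1 := by
  refine ((intervalIntegrable_majorant hβ 0 1).const_mul (32 * K ^ 2 * B ^ 3)).mono_fun' ?_ ?_
  · refine ((continuousOn_collisionIntegrand hω hf.continuousOn).mono ?_).aestronglyMeasurable
      measurableSet_uIoc
    intro u hu
    rw [uIoc_of_le zero_le_one] at hu
    exact hu.1
  · refine (ae_restrict_iff' measurableSet_uIoc).2 (Filter.Eventually.of_forall fun u hu => ?_)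
    rw [uIoc_of_le zero_le_one] at hu
    exact abs_collisionIntegrand_le (hK u hu) hu hω hf

/-! ### The cross terms -/

theorem abs_log_one_add_sub_le {x y : ℝ} (hx : 0 < x) (hy : 0 < y) :
    |Real.log (1 + x) - Real.log (1 + y)| ≤ |x - y| := by
  have key : ∀ {x y : ℝ}, 0 < x → 0 < y → Real.log (1 + x) - Real.log (1 + y) ≤ |x - y| := by
    intro x y hx hy
    rw [← Real.log_div (by positivity) (by positivity)]
    refine (Real.log_le_sub_one_of_pos (by positivity)).trans ?_
    rw [div_sub_one (by positivity), div_le_iff₀ (by positivity)]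
    nlinarith [le_abs_self (x - y), abs_nonneg (x - y)]
  rw [abs_le]
  constructor
  · have := key hy hx
    rw [abs_sub_comm] at this
    linarith
  · exact key hx hy

theorem LogLip.bddLip_comp (hM : LogLip B M) {φ : ℝ → ℝ} (hφ : ∀ x ∈ Ioc (0 : ℝ) 1, 0 < φ x)
    (hlog : ∀ x ∈ Ioc (0 : ℝ) 1, ∀ y ∈ Ioc (0 : ℝ) 1,
      |Real.log (φ x) - Real.log (φ y)| ≤ |x - y|) : BddLip B (fun u => M (φ u)) :=
  ⟨fun x hx => hM.bound _ (hφ x hx), fun x hx y hy =>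
    (hM.lip _ _ (hφ x hx) (hφ y hy)).trans (mul_le_mul_of_nonneg_left (hlog x hx y hy) hM.nonneg)⟩

/-- The products of `M` have the form `M ω * M (ω * (1 + u))` or `M ω * M (ω / (1 + u))`. They are
Lipschitz in `u` uniformly in `ω`, because logarithmic distance is invariant under scaling, so they
can be absorbed into the regular factor of the kernel. -/
theorem exists_cross_integral_bound (β B : ℝ) : ∃ C : ℝ, 0 ≤ C ∧ ∀ (m δ ω : ℝ) (M W : ℝ → ℝ),
    0 < δ → δ ≤ 1 → 0 < ω → LogLip B M → ContinuousOn W (Ioi 0) → (∀ x, 0 < x → |W x| ≤ m) →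
    ∫ u in δ..1, (weight β u 3 * crossCluster M W ω u 3 - weight β u 2 * crossCluster M W ω u 2) ≤
      C * m := by
  obtain ⟨C, hC0, hC⟩ := exists_cross_bound
  obtain ⟨R, hR0, hR⟩ := exists_reg_bound β
  refine ⟨8 * C * R * B ^ 2, by positivity, fun m δ ω M W hδ hδ1 hω hM hW hWm => ?_⟩
  have hc : ∀ k, ContinuousOn (fun u => weight β u k * crossCluster M W ω u k) (Ioi 0) := fun k =>
    (continuousOn_weight β k).mul (continuousOn_crossCluster hω hM.continuousOn hW k)
  rw [intervalIntegral.integral_sub (intervalIntegrable_of_Ioi (hc 3) hδ one_pos)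
    (intervalIntegrable_of_Ioi (hc 2) hδ one_pos)]
  have hconst : BddLip B (fun _ => M ω) :=
    hM.bddLip_comp (φ := fun _ => ω) (fun _ _ => hω) (fun x _ y _ => by simp)
  have hadd : BddLip B (fun u => M (ω * (1 + u))) := hM.bddLip_comp
    (fun x hx => mul_pos hω (by linarith [hx.1])) fun x hx y hy => by
      rw [Real.log_mul hω.ne' (by linarith [hx.1]), Real.log_mul hω.ne' (by linarith [hy.1]),
        add_sub_add_left_eq_sub]
      exact abs_log_one_add_sub_le hx.1 hy.1
  have hdiv : BddLip B (fun u => M (ω / (1 + u))) := hM.bddLip_comp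
    (fun x hx => div_pos hω (by linarith [hx.1])) fun x hx y hy => by
      rw [Real.log_div hω.ne' (by linarith [hx.1]), Real.log_div hω.ne' (by linarith [hy.1]),
        sub_sub_sub_cancel_left, abs_sub_comm]
      exact abs_log_one_add_sub_le hx.1 hy.1
  have hr2 : BddLip R (regTwo β) := ⟨fun x hx => (hR x hx).1.1, fun x hx y hy => (hR x hx).1.2 y hy⟩
  have hr3 : BddLip R (regThree β) :=
    ⟨fun x hx => (hR x hx).2.1, fun x hx y hy => (hR x hx).2.2 y hy⟩
  have hId : ContinuousOn (fun u : ℝ => u) (Ioc 0 1) := continuousOn_id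
  have g2 : ContinuousOn (fun u => W (ω / u)) (Ioc 0 1) :=
    hW.comp (continuousOn_const.div hId fun u hu => hu.1.ne') fun u hu => div_pos hω hu.1
  have g3 : ContinuousOn (fun u => W (ω * (1 + u) / u)) (Ioc 0 1) :=
    hW.comp (ContinuousOn.div (by fun_prop) hId fun u hu => hu.1.ne') fun u hu =>
      div_pos (mul_pos hω (by linarith [hu.1])) hu.1
  have b2 := hC _ m δ _ _ _ _ hδ hδ1 (hr2.mul (hconst.mul hdiv)) g2
    (fun u hu => hWm _ (div_pos hω hu.1)) nearIdentity_v_two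
  have b3 := hC _ m δ _ _ _ _ hδ hδ1 (hr3.mul (hadd.mul hconst)) g3
    (fun u hu => hWm _ (div_pos (mul_pos hω (by linarith [hu.1])) hu.1)) nearIdentity_inv
  have hpos : ∀ u ∈ uIcc δ 1, 0 < u := fun u hu => by
    rw [uIcc_of_le hδ1] at hu
    exact hδ.trans_le hu.1
  have i2 : ∫ u in δ..1, weight β u 2 * crossCluster M W ω u 2 =
      ∫ u in δ..1, u ^ (-(3 / 2) : ℝ) * (regTwo β u * (M ω * M (ω / (1 + u)))) *
        (W (ω / u) - W (ω / (u * (1 + u) / (1 + u + u ^ 2)))) := by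
    refine intervalIntegral.integral_congr fun u hu => ?_
    have hu0 := hpos u hu
    have hS : 1 + u + u ^ 2 ≠ 0 := by positivity
    have h1 : 1 + u ≠ 0 := by positivity
    have e0 : ω * v u 0 / v u 2 = ω / u := by rw [v_zero, v_two]; field_simp
    have e1 : ω * v u 1 / v u 2 = ω / (u * (1 + u) / (1 + u + u ^ 2)) := by
      rw [v_one, v_two, mul_one]
    have e2 : ω * v u 2 / v u 2 = ω := mul_div_cancel_right₀ _ (v_pos hu0 2).ne'
    have e3 : ω * v u 3 / v u 2 = ω / (1 + u) := by rw [v_three, v_two]; field_simp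
    simp only [crossCluster, weight_two β hu0, e0, e1, e2, e3]
    ring
  have i3 : ∫ u in δ..1, weight β u 3 * crossCluster M W ω u 3 =
      ∫ u in δ..1, u ^ (-(3 / 2) : ℝ) * (regThree β u * (M (ω * (1 + u)) * M ω)) *
        (W (ω * (1 + u) / u) - W (ω * (1 + u / (1 + u ^ 2)) / (u / (1 + u ^ 2)))) := by
    refine intervalIntegral.integral_congr fun u hu => ?_
    have hu0 := hpos u hu
    have hS : 1 + u + u ^ 2 ≠ 0 := by positivity
    have h1 : 1 + u ^ 2 ≠ 0 := by positivity
    have e0 : ω * v u 0 / v u 3 = ω * (1 + u) / u := by rw [v_zero, v_three]; field_simp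
    have e1 : ω * v u 1 / v u 3 = ω * (1 + u / (1 + u ^ 2)) / (u / (1 + u ^ 2)) := by
      rw [v_one, v_three]; field_simp; ring
    have e2 : ω * v u 2 / v u 3 = ω * (1 + u) := by rw [v_two, v_three]; field_simp
    have e3 : ω * v u 3 / v u 3 = ω := mul_div_cancel_right₀ _ (v_pos hu0 3).ne'
    simp only [crossCluster, weight_three β hu0, e0, e1, e2, e3]
    ring
  rw [i2, i3]
  have c2 := (abs_le.1 b2).1
  have c3 := (abs_le.1 b3).2
  refine (sub_le_sub c3 c2).trans (le_of_eq ?_)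
  ring

/-! ### One-sided bound for the collision operator -/

theorem continuousOn_damping (β : ℝ) : ContinuousOn (damping β) (Ioi 0) :=
  (continuousOn_id.rpow_const fun _ hu => Or.inl (ne_of_gt hu)).add
    (continuousOn_id.rpow_const fun _ hu => Or.inl (ne_of_gt hu))

theorem damping_nonneg (β : ℝ) {u : ℝ} (hu : 0 < u) : 0 ≤ damping β u := by
  unfold damping; positivity

theorem continuousOn_linIntegrand (hω : 0 < ω) (hM : ContinuousOn M (Ioi 0))
    (hN : ContinuousOn N (Ioi 0)) (hW : ContinuousOn W (Ioi 0)) :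
    ContinuousOn (linIntegrand β M N W ω) (Ioi 0) := by
  have hc : ∀ k, ContinuousOn (fun u => weight β u k * linCluster β M N W ω u k) (Ioi 0) := by
    intro k
    have cM := fun i => continuousOn_comp_v hω hM i k
    have cN := fun i => continuousOn_comp_v hω hN i k
    have cW := fun i => continuousOn_comp_v hω hW i k
    exact (continuousOn_weight β k).mul
      ((((((cM 2).mul (cM 3)).mul (continuousOn_nearDiff hω hW k)).add
        ((continuousOn_nearDiff hω hN k).mul (((cN 2).mul (cW 3)).add ((cW 2).mul (cM 3))))).add
        (((cM 0).mul (cM 1)).mul (continuousOn_farDiff hω hW k))).add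
        ((continuousOn_farDiff hω hN k).mul (((cN 0).mul (cW 1)).add ((cW 0).mul (cM 1)))))
  exact (((hc 0).neg.add (hc 1)).sub (hc 2)).add (hc 3)

/-- The order of quantifiers matters: `C` is fixed before `δ`, while `Λ` contains the integral of
`damping` over `[δ, 1]`, which need not stay bounded as `δ → 0`. -/
theorem exists_integral_linIntegrand_le (hβ : β ∈ Ioo (-1 : ℝ) 1) (B : ℝ) :
    ∃ C : ℝ, 0 ≤ C ∧ ∀ δ, 0 < δ → δ ≤ 1 → ∃ Λ : ℝ, 0 ≤ Λ ∧ ∀ (m ω : ℝ) (M N W : ℝ → ℝ), 0 < ω →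
      Comparison B m M N W → ContinuousOn W (Ioi 0) →
      ∫ u in δ..1, linIntegrand β M N W ω u ≤ Λ * (m - W ω) + C * m := by
  obtain ⟨C, hC0, hC⟩ := exists_cross_integral_bound β B
  obtain ⟨K, hK⟩ := exists_weightBounds β
  have hmaj0 : 0 ≤ ∫ u in (0 : ℝ)..1, majorant β u :=
    intervalIntegral.integral_nonneg zero_le_one fun u hu => majorant_nonneg β hu.1
  refine ⟨C + 228 * K ^ 2 * B ^ 2 * ∫ u in (0 : ℝ)..1, majorant β u, by positivity,
    fun δ hδ hδ1 => ⟨4 * B ^ 2 * K ^ 2 * ∫ u in δ..1, damping β u, ?_,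
      fun m ω M N W hω hc hW => ?_⟩⟩
  · exact mul_nonneg (by positivity) (intervalIntegral.integral_nonneg hδ1 fun u hu =>
      damping_nonneg β (hδ.trans_le hu.1))
  have hm := hc.m_nonneg
  have ii : ∀ {F : ℝ → ℝ}, ContinuousOn F (Ioi 0) → IntervalIntegrable F volume δ 1 := fun hF =>
    intervalIntegrable_of_Ioi hF hδ one_pos
  have cX : ContinuousOn (fun u => weight β u 3 * crossCluster M W ω u 3 -
      weight β u 2 * crossCluster M W ω u 2) (Ioi 0) :=
    ((continuousOn_weight β 3).mul (continuousOn_crossCluster hω hc.hM.continuousOn hW 3)).sub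
      ((continuousOn_weight β 2).mul (continuousOn_crossCluster hω hc.hM.continuousOn hW 2))
  have i1 := ii cX
  have i2 : IntervalIntegrable (fun u => 4 * B ^ 2 * K ^ 2 * damping β u * (m - W ω)) volume δ 1 :=
    ii ((continuousOn_const.mul (continuousOn_damping β)).mul continuousOn_const)
  have i3 : IntervalIntegrable (fun u => 228 * K ^ 2 * B ^ 2 * m * majorant β u) volume δ 1 :=
    (intervalIntegrable_majorant hβ δ 1).const_mul _
  have mono := intervalIntegral.integral_mono_on hδ1
    (ii (continuousOn_linIntegrand (β := β) hω hc.hM.continuousOn hc.hN.continuousOn hW))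
    ((i1.add i2).add i3) fun u hu => linIntegrand_le (hK u ⟨hδ.trans_le hu.1, hu.2⟩)
      ⟨hδ.trans_le hu.1, hu.2⟩ hω hc
  refine mono.trans ?_
  have i12 : IntervalIntegrable (fun u => (weight β u 3 * crossCluster M W ω u 3 -
      weight β u 2 * crossCluster M W ω u 2) + 4 * B ^ 2 * K ^ 2 * damping β u * (m - W ω))
      volume δ 1 := i1.add i2
  rw [intervalIntegral.integral_add i12 i3, intervalIntegral.integral_add i1 i2,
    intervalIntegral.integral_mul_const, intervalIntegral.integral_const_mul,
    intervalIntegral.integral_const_mul]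
  have hX := hC m δ ω M W hδ hδ1 hω hc.hM hW hc.W_le
  have hmaj : ∫ u in δ..1, majorant β u ≤ ∫ u in (0 : ℝ)..1, majorant β u := by
    rw [← intervalIntegral.integral_add_adjacent_intervals
      (intervalIntegrable_majorant hβ 0 δ) (intervalIntegrable_majorant hβ δ 1)]
    linarith [intervalIntegral.integral_nonneg (μ := volume) hδ.le
      fun u hu => majorant_nonneg β (u := u) hu.1]
  have := mul_le_mul_of_nonneg_left hmaj (by positivity : 0 ≤ 228 * K ^ 2 * B ^ 2 * m)
  linarith

theorem exists_small_majorant (hβ : β ∈ Ioo (-1 : ℝ) 1) {A η : ℝ} (hη : 0 < η) :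
    ∃ δ : ℝ, 0 < δ ∧ δ ≤ 1 ∧ A * ∫ u in (0 : ℝ)..δ, majorant β u ≤ η := by
  have h1 := intervalIntegral.continuousOn_primitive_interval (μ := volume) (a := 0) (b := 1)
    (f := majorant β) (by
      have := (intervalIntegrable_iff_integrableOn_Icc_of_le zero_le_one).1
        (intervalIntegrable_majorant hβ 0 1)
      rwa [uIcc_of_le zero_le_one])
  rw [uIcc_of_le zero_le_one] at h1
  have h2 : ContinuousWithinAt (fun x => A * ∫ u in (0 : ℝ)..x, majorant β u) (Icc 0 1) 0 :=
    (h1 0 (by norm_num)).const_smul A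
  have h3 : ∀ᶠ x in nhdsWithin (0 : ℝ) (Icc 0 1), A * ∫ u in (0 : ℝ)..x, majorant β u < η := by
    refine h2.eventually_lt continuousWithinAt_const ?_
    simpa using hη
  have h4 : ∀ᶠ x in nhdsWithin (0 : ℝ) (Ioc 0 1), A * ∫ u in (0 : ℝ)..x, majorant β u < η :=
    h3.filter_mono (nhdsWithin_mono _ Ioc_subset_Icc_self)
  have : (nhdsWithin (0 : ℝ) (Ioc 0 1)).NeBot := by
    rw [nhdsWithin_Ioc_eq_nhdsGT zero_lt_one]; infer_instance
  obtain ⟨δ, hδ, hδm⟩ := (h4.and self_mem_nhdsWithin).exists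
  exact ⟨δ, hδm.1, hδm.2, hδ.le⟩

/-- The linearized collision operator satisfies a maximum principle up to bounded terms. -/
theorem exists_collision_sub_le (hβ : β ∈ Ioo (-1 : ℝ) 1) (B : ℝ) :
    ∃ C : ℝ, 0 ≤ C ∧ ∀ η, 0 < η → ∃ Λ : ℝ, 0 ≤ Λ ∧ ∀ (m ω : ℝ) (M N : ℝ → ℝ), 0 < ω →
      Comparison B m M N (fun x => N x - M x) →
      collision β N ω - collision β M ω ≤ Λ * (m - (N ω - M ω)) + C * m + η ∧
      collision β M ω - collision β N ω ≤ Λ * (m - (M ω - N ω)) + C * m + η := by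
  obtain ⟨C, hC0, hC⟩ := exists_integral_linIntegrand_le hβ B
  obtain ⟨K, hK⟩ := exists_weightBounds β
  refine ⟨C, hC0, fun η hη => ?_⟩
  -- The factor `64 = 2 * 32` bounds the integrands of `N` and `M` together on `[0, δ]`.
  obtain ⟨δ, hδ, hδ1, hsmall⟩ := exists_small_majorant hβ (A := 64 * K ^ 2 * B ^ 3) hη
  obtain ⟨Λ, hΛ0, hΛ⟩ := hC δ hδ hδ1
  refine ⟨Λ, hΛ0, fun m ω M N hω hc => ?_⟩
  have cW : ContinuousOn (fun x => N x - M x) (Ioi 0) :=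
    hc.hN.continuousOn.sub hc.hM.continuousOn
  have iN := intervalIntegrable_collisionIntegrand hβ hK hω hc.hN
  have iM := intervalIntegrable_collisionIntegrand hβ hK hω hc.hM
  have s0 : uIcc 0 δ ⊆ uIcc (0 : ℝ) 1 := uIcc_subset_uIcc_left (by
    rw [uIcc_of_le zero_le_one]; exact ⟨hδ.le, hδ1⟩)
  have s1 : uIcc δ 1 ⊆ uIcc (0 : ℝ) 1 := uIcc_subset_uIcc_right (by
    rw [uIcc_of_le zero_le_one]; exact ⟨hδ.le, hδ1⟩)
  have e : collision β N ω - collision β M ω =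
      (∫ u in (0 : ℝ)..δ, (collisionIntegrand β N ω u - collisionIntegrand β M ω u)) +
        ∫ u in δ..1, linIntegrand β M N (fun x => N x - M x) ω u := by
    simp only [← collisionIntegrand_sub]
    rw [intervalIntegral.integral_add_adjacent_intervals
      ((iN.mono_set s0).sub (iM.mono_set s0)) ((iN.mono_set s1).sub (iM.mono_set s1)),
      intervalIntegral.integral_sub iN iM, ← collision_eq, ← collision_eq]
  have hin :
      |∫ u in (0 : ℝ)..δ, (collisionIntegrand β N ω u - collisionIntegrand β M ω u)| ≤ η := by
    refine le_trans ?_ hsmall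
    rw [← intervalIntegral.integral_const_mul, ← Real.norm_eq_abs]
    refine intervalIntegral.norm_integral_le_of_norm_le hδ.le
      (Filter.Eventually.of_forall fun u hu => ?_) ((intervalIntegrable_majorant hβ 0 δ).const_mul _)
    have hu' : u ∈ Ioc (0 : ℝ) 1 := ⟨hu.1, hu.2.trans hδ1⟩
    have a1 := abs_collisionIntegrand_le (hK u hu') hu' hω hc.hN
    have a2 := abs_collisionIntegrand_le (hK u hu') hu' hω hc.hM
    rw [Real.norm_eq_abs]
    refine (abs_sub _ _).trans ?_
    linarith
  have u1 := hΛ m ω M N _ hω hc cW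
  -- Only the sign of `W` changes; `M` and `N` keep their roles, so `M` alone has to be nonnegative.
  have u2 := hΛ m ω M N _ hω hc.neg cW.neg
  have e2 : ∫ u in δ..1, linIntegrand β M N (fun x => -(N x - M x)) ω u =
      -∫ u in δ..1, linIntegrand β M N (fun x => N x - M x) ω u := by
    rw [← intervalIntegral.integral_neg]
    exact intervalIntegral.integral_congr fun u _ => linIntegrand_neg β M N _ ω u
  rw [e2] at u2
  have hin' := abs_le.1 hin
  constructor
  · rw [e]; linarith
  · have e3 : collision β M ω - collision β N ω = -(collision β N ω - collision β M ω) := by ring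
    rw [e3, e]; linarith

end KineticMMT
end

noncomputable section

namespace KineticMMT

/-! ### The space `X` -/

variable {β : ℝ} {p₀ : ℕ} {f : ℝ → ℝ}

theorem le_of_ae_halfLine_le {B : ℝ} (hf : ContinuousOn f (Ioi 0))
    (h : ∀ᵐ x ∂halfLine, f x ≤ B) : ∀ x, 0 < x → f x ≤ B := by
  intro x hx
  by_contra hlt
  have hopen : IsOpen (Ioi 0 ∩ f ⁻¹' Ioi B) := hf.isOpen_inter_preimage isOpen_Ioi isOpen_Ioi
  have hpos := hopen.measure_pos volume ⟨x, hx, not_le.1 hlt⟩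
  rw [halfLine, ae_restrict_iff' measurableSet_Ioi, ae_iff] at h
  refine hpos.ne' (measure_mono_null (fun y hy => ?_) h)
  simpa using hy

theorem abs_le_of_ae_halfLine {B : ℝ} (hf : ContinuousOn f (Ioi 0))
    (h : ∀ᵐ x ∂halfLine, |f x| ≤ B) : ∀ x, 0 < x → |f x| ≤ B :=
  le_of_ae_halfLine_le hf.abs h

theorem LocallyAC.continuousOn (hf : LocallyAC f) : ContinuousOn f (Ioi 0) := by
  intro x hx
  have hx0 : (0 : ℝ) < x := hx
  have h := (hf (x / 2) (2 * x) (by positivity) (by linarith)).continuousOn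
  rw [uIcc_of_le (by linarith)] at h
  exact (h.continuousAt (Icc_mem_nhds (by linarith) (by linarith))).continuousWithinAt

theorem ae_abs_le_of_eLpNorm_le {B : ℝ≥0} {μ : Measure ℝ} (h : eLpNorm f ∞ μ ≤ B) :
    ∀ᵐ x ∂μ, |f x| ≤ B := by
  rw [eLpNorm_exponent_top] at h
  filter_upwards [ae_le_eLpNormEssSup (f := f) (μ := μ)] with x hx
  have h1 := hx.trans h
  rw [enorm_le_coe] at h1
  exact_mod_cast h1

/-- The bound `|f' x| ≤ B / x` integrates to a logarithm. -/
theorem LocallyAC.abs_sub_le {B : ℝ} (hf : LocallyAC f) (hB : ∀ᵐ x ∂halfLine, |D f x| ≤ B)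
    {a b : ℝ} (ha : 0 < a) (hab : a ≤ b) : |f b - f a| ≤ B * (Real.log b - Real.log a) := by
  have hac := hf a b ha hab
  rw [← hac.integral_deriv_eq_sub, ← Real.log_div (by linarith) ha.ne',
    ← integral_inv_of_pos ha (by linarith), ← intervalIntegral.integral_const_mul,
    ← Real.norm_eq_abs]
  have h0 : (0 : ℝ) ∉ uIcc a b := by
    rw [uIcc_of_le hab]; exact fun h => by linarith [h.1]
  refine intervalIntegral.norm_integral_le_of_norm_le hab ?_
    ((intervalIntegral.intervalIntegrable_inv (fun x hx => ne_of_mem_of_not_mem hx h0)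
      continuousOn_id).const_mul B)
  rw [halfLine, ae_restrict_iff' measurableSet_Ioi] at hB
  filter_upwards [hB] with x hx hxab
  have hx0 : 0 < x := ha.trans hxab.1
  have := hx hx0
  rw [D, abs_mul, abs_of_pos hx0] at this
  rw [Real.norm_eq_abs, ← div_eq_mul_inv, le_div_iff₀ hx0]
  linarith

theorem MemX.logLip {B : ℝ≥0} (hf : MemX p₀ f) (hB : xNorm p₀ f ≤ B) : LogLip B f := by
  have h1 : ∀ᵐ x ∂halfLine, |f x| ≤ B :=
    ae_abs_le_of_eLpNorm_le ((le_self_add.trans le_self_add).trans hB)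
  have h2 : ∀ᵐ x ∂halfLine, |D f x| ≤ B := ae_abs_le_of_eLpNorm_le (le_add_self.trans hB)
  refine ⟨abs_le_of_ae_halfLine hf.1.continuousOn h1, fun x y hx hy => ?_⟩
  rcases le_total x y with h | h
  · have := hf.1.abs_sub_le h2 hx h
    rw [abs_sub_comm, abs_sub_comm (Real.log x)]
    exact this.trans (mul_le_mul_of_nonneg_left (le_abs_self _) B.2)
  · exact (hf.1.abs_sub_le h2 hy h).trans (mul_le_mul_of_nonneg_left (le_abs_self _) B.2)

/-! ### Bounds for strong solutions -/

theorem timeInterval_mono {s t : ℝ} (h : s ≤ t) : timeInterval s ≤ timeInterval t :=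
  Measure.restrict_mono (Ioo_subset_Ioo_right h) le_rfl

/-- Exchanging the order lets the equation be read as a differential inequality in time at a fixed
frequency. -/
theorem ae_ae_swap {T : ℝ} {p : ℝ → ℝ → Prop}
    (h : ∀ᵐ z ∂((timeInterval T).prod halfLine), p z.1 z.2) :
    ∀ᵐ ω ∂halfLine, ∀ᵐ t ∂(timeInterval T), p t ω := by
  have : SFinite (timeInterval T) := by unfold timeInterval; infer_instance
  have : SFinite halfLine := by unfold halfLine; infer_instance
  rw [← Measure.prod_swap] at h
  exact Measure.ae_ae_of_ae_prod (ae_of_ae_map measurable_swap.aemeasurable h)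

namespace IsStrongSolution

variable {T : ℝ} {N₀ : ℝ → ℝ} {N Nt : ℝ → ℝ → ℝ}

theorem ae_xNorm_le (h : IsStrongSolution β p₀ T N₀ N Nt) :
    ∀ᵐ t ∂(timeInterval T),
      xNorm p₀ (N t) ≤ (essSup (fun t => xNorm p₀ (N t)) (timeInterval T)).toNNReal := by
  rw [ENNReal.coe_toNNReal h.essSup_xNorm_lt_top.ne]
  exact ENNReal.ae_le_essSup _

theorem exists_logLip (h : IsStrongSolution β p₀ T N₀ N Nt) :
    ∃ B : ℝ, ∀ᵐ t ∂(timeInterval T), LogLip B (N t) := by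
  refine ⟨(essSup (fun t => xNorm p₀ (N t)) (timeInterval T)).toNNReal, ?_⟩
  filter_upwards [h.memX, h.ae_xNorm_le] with t h1 h2 using h1.logLip h2

theorem ae_equation (h : IsStrongSolution β p₀ T N₀ N Nt) :
    ∀ᵐ ω ∂halfLine, ∀ᵐ t ∂(timeInterval T), Nt t ω = collision β (N t) ω :=
  ae_ae_swap (p := fun t ω => Nt t ω = collision β (N t) ω) h.equation

/-- A strong solution moves at bounded speed. -/
theorem exists_abs_sub_le (h : IsStrongSolution β p₀ T N₀ N Nt) (hN₀ : MemX p₀ N₀) :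
    ∃ K : ℝ, 0 ≤ K ∧ ∀ᵐ t ∂(timeInterval T), ∀ ω, 0 < ω → |N t ω - N₀ ω| ≤ K * t := by
  have h1 : ∀ᵐ z ∂((timeInterval T).prod halfLine),
      |Nt z.1 z.2| ≤ (eLpNorm (Function.uncurry Nt) ∞ ((timeInterval T).prod halfLine)).toNNReal := by
    have hlt := h.memLp_timeDeriv.2
    have hle := ENNReal.coe_toNNReal hlt.ne
    rw [eLpNorm_exponent_top] at hle ⊢
    filter_upwards [ae_le_eLpNormEssSup (f := Function.uncurry Nt)
      (μ := (timeInterval T).prod halfLine)] with z hz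
    rw [← hle, enorm_le_coe] at hz
    exact_mod_cast hz
  set K := (eLpNorm (Function.uncurry Nt) ∞ ((timeInterval T).prod halfLine)).toNNReal
  refine ⟨K, K.2, ?_⟩
  have h2 : ∀ᵐ ω ∂halfLine, ∀ t ∈ Ioo (0 : ℝ) T, |N t ω - N₀ ω| ≤ K * t := by
    have hpos : ∀ᵐ ω ∂halfLine, 0 < ω := ae_restrict_mem measurableSet_Ioi
    filter_upwards [ae_ae_swap (p := fun t ω => |Nt t ω| ≤ K) h1, hpos] with ω hω hω0 t ht
    rw [h.eq_add_integral ω hω0 t ⟨ht.1.le, ht.2.le⟩, add_sub_cancel_left]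
    rw [timeInterval, ae_restrict_iff' measurableSet_Ioo] at hω
    have := intervalIntegral.norm_integral_le_of_norm_le_const_ae (a := 0) (b := t)
      (f := fun s => Nt s ω) (C := K) (by
        filter_upwards [hω] with s hs hst
        rw [uIoc_of_le ht.1.le] at hst
        exact hs ⟨hst.1, hst.2.trans_lt ht.2⟩)
    rwa [sub_zero, abs_of_pos ht.1] at this
  have h3 : ∀ᵐ t ∂(timeInterval T), t ∈ Ioo 0 T := ae_restrict_mem measurableSet_Ioo
  filter_upwards [h.memX, h3] with t ht htT
  refine abs_le_of_ae_halfLine (f := fun ω => N t ω - N₀ ω)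
    (ht.1.continuousOn.sub hN₀.1.continuousOn) ?_
  filter_upwards [h2] with ω hω
  exact hω t htT

end IsStrongSolution

/-! ### A comparison principle in time -/

/-- If `G t > 0`, take the last time `t₀ ≤ t` at which `G ≤ 0`. After it `G` is positive, so `G' ≤
0` almost everywhere and `G` cannot have risen. -/
theorem nonpos_of_deriv_le_neg_mul {Λ τ : ℝ} {G G' : ℝ → ℝ} (hΛ : 0 ≤ Λ)
    (hi : IntervalIntegrable G' volume 0 τ) (hG : ∀ t ∈ Icc 0 τ, G t = ∫ s in (0 : ℝ)..t, G' s)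
    (h : ∀ᵐ s ∂(timeInterval τ), G' s ≤ -(Λ * G s)) : ∀ t ∈ Icc 0 τ, G t ≤ 0 := by
  intro t ht
  by_contra hpos
  push Not at hpos
  have hτ : 0 ≤ τ := ht.1.trans ht.2
  have hcont : ContinuousOn G (Icc 0 τ) := by
    have := intervalIntegral.continuousOn_primitive_interval (μ := volume) (a := 0) (b := τ)
      (f := G') (by
        rw [uIcc_of_le hτ]
        exact (intervalIntegrable_iff_integrableOn_Icc_of_le hτ).1 hi)
    rw [uIcc_of_le hτ] at this
    exact this.congr hG
  have hsub : Icc 0 t ⊆ Icc 0 τ := Icc_subset_Icc_right ht.2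
  have hcl : IsClosed (Icc 0 t ∩ G ⁻¹' Iic 0) :=
    (hcont.mono hsub).preimage_isClosed_of_isClosed isClosed_Icc isClosed_Iic
  have hcpt : IsCompact (Icc 0 t ∩ G ⁻¹' Iic 0) :=
    isCompact_Icc.of_isClosed_subset hcl inter_subset_left
  have h0 : (0 : ℝ) ∈ Icc 0 t ∩ G ⁻¹' Iic 0 := by
    refine ⟨⟨le_rfl, ht.1⟩, ?_⟩
    simp [hG 0 ⟨le_rfl, hτ⟩]
  obtain ⟨t₀, ⟨ht₀, hG₀⟩, hmax⟩ := hcpt.exists_isMaxOn ⟨0, h0⟩ continuousOn_id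
  have hgt : ∀ s ∈ Ioc t₀ t, 0 < G s := by
    intro s hs
    by_contra hle
    have : s ≤ t₀ := hmax ⟨⟨ht₀.1.trans hs.1.le, hs.2⟩, not_lt.1 hle⟩
    linarith [hs.1]
  have hi1 : IntervalIntegrable G' volume 0 t₀ := hi.mono_set (by
    rw [uIcc_of_le hτ, uIcc_of_le ht₀.1]; exact Icc_subset_Icc_right (ht₀.2.trans ht.2))
  have hi2 : IntervalIntegrable G' volume t₀ t := hi.mono_set (by
    rw [uIcc_of_le hτ, uIcc_of_le ht₀.2]; exact Icc_subset_Icc ht₀.1 ht.2)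
  have e : G t = G t₀ + ∫ s in t₀..t, G' s := by
    rw [hG t ht, hG t₀ (hsub ht₀), intervalIntegral.integral_add_adjacent_intervals hi1 hi2]
  have hneg : ∫ s in t₀..t, G' s ≤ 0 := by
    rw [intervalIntegral.integral_of_le ht₀.2, integral_Ioc_eq_integral_Ioo]
    refine setIntegral_nonpos_of_ae_restrict ?_
    rw [timeInterval, ae_restrict_iff' measurableSet_Ioo] at h
    refine (ae_restrict_iff' measurableSet_Ioo).2 ?_
    filter_upwards [h] with s hs hst
    have h1 := hs ⟨ht₀.1.trans_lt hst.1, hst.2.trans_le ht.2⟩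
    have h2 := mul_nonneg hΛ (hgt s ⟨hst.1, hst.2.le⟩).le
    simp only [Pi.zero_apply]
    linarith
  have : G t₀ ≤ 0 := hG₀
  linarith

/-- With `E s = exp (C s) * (A + η s)`, the function `Y = E - A * exp (-Λ s)` vanishes at zero and
satisfies `Y' ≥ Λ * (E - Y) + C * E + η`, so it dominates `g`. The conclusion has the shape of `E`
with a smaller amplitude, which allows iteration. -/
theorem comparison_step {Λ C A η τ : ℝ} {g g' : ℝ → ℝ} (hΛ : 0 ≤ Λ) (hC : 0 ≤ C)
    (hA : 0 ≤ A) (hη : 0 ≤ η) (hi : IntervalIntegrable g' volume 0 τ)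
    (hg : ∀ t ∈ Icc 0 τ, g t = ∫ s in (0 : ℝ)..t, g' s)
    (h : ∀ᵐ s ∂(timeInterval τ), g' s ≤ Λ * (Real.exp (C * s) * (A + η * s) - g s) +
      C * (Real.exp (C * s) * (A + η * s)) + η) :
    ∀ t ∈ Icc 0 τ, g t ≤
      Real.exp (C * t) * (A * (1 - Real.exp (-((Λ + C) * τ))) + η * t) := by
  set Y : ℝ → ℝ := fun s => Real.exp (C * s) * (A + η * s) - A * Real.exp (-(Λ * s)) with hY
  set Y' : ℝ → ℝ := fun s => C * (Real.exp (C * s) * (A + η * s)) + η * Real.exp (C * s) +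
    Λ * (A * Real.exp (-(Λ * s))) with hY'
  have hd : ∀ s, HasDerivAt Y (Y' s) s := by
    intro s
    have h1 : HasDerivAt (fun s => Real.exp (C * s)) (Real.exp (C * s) * (C * 1)) s :=
      ((hasDerivAt_id' s).const_mul C).exp
    have h2 : HasDerivAt (fun s => A + η * s) (η * 1) s :=
      ((hasDerivAt_id' s).const_mul η).const_add A
    have h3 : HasDerivAt (fun s => Real.exp (-(Λ * s))) (Real.exp (-(Λ * s)) * (-(Λ * 1))) s :=
      ((hasDerivAt_id' s).const_mul Λ).fun_neg.exp
    refine ((h1.fun_mul h2).fun_sub (h3.const_mul A)).congr_deriv ?_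
    simp only [hY']; ring
  have hYc : Continuous Y' := by fun_prop
  have hYint : ∀ t, Y t = ∫ s in (0 : ℝ)..t, Y' s := by
    intro t
    rw [intervalIntegral.integral_eq_sub_of_hasDerivAt (fun s _ => hd s)
      (hYc.intervalIntegrable _ _)]
    simp [hY]
  have key := nonpos_of_deriv_le_neg_mul (G := fun t => g t - Y t) (G' := fun s => g' s - Y' s)
    hΛ (hi.sub (hYc.intervalIntegrable _ _)) (fun t ht => by
      have hit : IntervalIntegrable g' volume 0 t := hi.mono_set (by
        rw [uIcc_of_le (ht.1.trans ht.2), uIcc_of_le ht.1]; exact Icc_subset_Icc_right ht.2)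
      rw [intervalIntegral.integral_sub hit (hYc.intervalIntegrable _ _), hg t ht, hYint t]) (by
      have hpos : ∀ᵐ s ∂(timeInterval τ), s ∈ Ioo 0 τ := ae_restrict_mem measurableSet_Ioo
      filter_upwards [h, hpos] with s hs hs0
      have h1 : 1 ≤ Real.exp (C * s) := Real.one_le_exp (mul_nonneg hC hs0.1.le)
      have h2 := mul_le_mul_of_nonneg_left h1 hη
      simp only [hY, hY']
      linarith)
  intro t ht
  have h1 := key t ht
  -- Bounding `exp (-Λ t)` below by a fixed fraction of `exp (C t)` makes the contraction factor
  -- independent of `t`.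
  have h2 : Real.exp (C * t) * Real.exp (-((Λ + C) * τ)) ≤ Real.exp (-(Λ * t)) := by
    rw [← Real.exp_add, Real.exp_le_exp]
    nlinarith [mul_nonneg (add_nonneg hΛ hC) (sub_nonneg.2 ht.2)]
  have h3 := mul_le_mul_of_nonneg_left h2 hA
  simp only [hY] at h1
  linarith

/-! ### Uniqueness -/

/-- Two strong solutions with the same initial value agree as long as one of them is
nonnegative. -/
theorem IsStrongSolution.ae_eq (hβ : β ∈ Ioo (-1 : ℝ) 1) {T T' τ : ℝ} {N₀ : ℝ → ℝ}
    {N Nt M Mt : ℝ → ℝ → ℝ} (hN : IsStrongSolution β p₀ T N₀ N Nt)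
    (hM : IsStrongSolution β p₀ T' N₀ M Mt) (hτT : τ ≤ T) (hτT' : τ ≤ T')
    (hpos : ∀ᵐ t ∂(timeInterval τ), ∀ ω, 0 < ω → 0 ≤ M t ω) :
    ∀ᵐ t ∂(timeInterval τ), ∀ ω, 0 < ω → N t ω = M t ω := by
  obtain ⟨B₁, hB₁⟩ := hN.exists_logLip
  obtain ⟨B₂, hB₂⟩ := hM.exists_logLip
  have hLN : ∀ᵐ t ∂(timeInterval τ), LogLip (max B₁ B₂) (N t) := by
    filter_upwards [ae_mono (timeInterval_mono hτT) hB₁] with t ht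
    exact ht.mono (le_max_left _ _)
  have hLM : ∀ᵐ t ∂(timeInterval τ), LogLip (max B₁ B₂) (M t) := by
    filter_upwards [ae_mono (timeInterval_mono hτT') hB₂] with t ht
    exact ht.mono (le_max_right _ _)
  set B := max B₁ B₂
  have hIoo : ∀ᵐ t ∂(timeInterval τ), t ∈ Ioo 0 τ := ae_restrict_mem measurableSet_Ioo
  have hω0 : ∀ᵐ ω ∂halfLine, 0 < ω := ae_restrict_mem measurableSet_Ioi
  have eqN : ∀ᵐ ω ∂halfLine, ∀ᵐ t ∂(timeInterval τ), Nt t ω = collision β (N t) ω := by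
    filter_upwards [hN.ae_equation] with ω hω using ae_mono (timeInterval_mono hτT) hω
  have eqM : ∀ᵐ ω ∂halfLine, ∀ᵐ t ∂(timeInterval τ), Mt t ω = collision β (M t) ω := by
    filter_upwards [hM.ae_equation] with ω hω using ae_mono (timeInterval_mono hτT') hω
  obtain ⟨C, hC0, hC⟩ := exists_collision_sub_le hβ B
  -- one contraction step
  have step : ∀ η, 0 < η → ∃ r : ℝ, 0 ≤ r ∧ r < 1 ∧ ∀ A, 0 ≤ A →
      (∀ᵐ t ∂(timeInterval τ), ∀ ω, 0 < ω →
        |N t ω - M t ω| ≤ Real.exp (C * t) * (A + η * t)) →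
      ∀ᵐ t ∂(timeInterval τ), ∀ ω, 0 < ω →
        |N t ω - M t ω| ≤ Real.exp (C * t) * (A * r + η * t) := by
    intro η hη
    rcases lt_or_ge τ 0 with hτ | hτ
    · refine ⟨0, le_rfl, one_pos, fun A _ _ => ?_⟩
      filter_upwards [hIoo] with t ht
      linarith [ht.1, ht.2]
    obtain ⟨Λ, hΛ0, hΛ⟩ := hC η hη
    refine ⟨1 - Real.exp (-((Λ + C) * τ)), ?_, ?_, fun A hA hbd => ?_⟩
    · have : Real.exp (-((Λ + C) * τ)) ≤ 1 :=
        Real.exp_le_one_iff.2 (neg_nonpos.2 (mul_nonneg (by linarith) hτ))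
      linarith
    · linarith [Real.exp_pos (-((Λ + C) * τ))]
    have hcmp : ∀ᵐ t ∂(timeInterval τ), Comparison B (Real.exp (C * t) * (A + η * t)) (M t) (N t)
        (fun x => N t x - M t x) := by
      filter_upwards [hLN, hLM, hpos, hbd] with t h1 h2 h3 h4 using ⟨h2, h1, h3, h4⟩
    have hall : ∀ᵐ ω ∂halfLine, ∀ t ∈ Icc 0 τ, |N t ω - M t ω| ≤
        Real.exp (C * t) * (A * (1 - Real.exp (-((Λ + C) * τ))) + η * t) := by
      filter_upwards [eqN, eqM, hω0] with ω h1 h2 hω t ht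
      have s1 : uIcc 0 τ ⊆ uIcc 0 T := by
        rw [uIcc_of_le hτ, uIcc_of_le (hτ.trans hτT)]; exact Icc_subset_Icc_right hτT
      have s2 : uIcc 0 τ ⊆ uIcc 0 T' := by
        rw [uIcc_of_le hτ, uIcc_of_le (hτ.trans hτT')]; exact Icc_subset_Icc_right hτT'
      have iN := (hN.intervalIntegrable ω hω).mono_set s1
      have iM := (hM.intervalIntegrable ω hω).mono_set s2
      have dW : ∀ t ∈ Icc 0 τ, N t ω - M t ω = ∫ s in (0 : ℝ)..t, (Nt s ω - Mt s ω) := by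
        intro t ht
        have st : uIcc 0 t ⊆ uIcc 0 τ := by
          rw [uIcc_of_le hτ, uIcc_of_le ht.1]; exact Icc_subset_Icc_right ht.2
        rw [hN.eq_add_integral ω hω t ⟨ht.1, ht.2.trans hτT⟩,
          hM.eq_add_integral ω hω t ⟨ht.1, ht.2.trans hτT'⟩,
          intervalIntegral.integral_sub (iN.mono_set st) (iM.mono_set st)]
        ring
      have u1 := comparison_step (g := fun t => N t ω - M t ω) (g' := fun s => Nt s ω - Mt s ω)
        hΛ0 hC0 hA hη.le (iN.sub iM) dW (by
          filter_upwards [hcmp, h1, h2] with s hs e1 e2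
          rw [e1, e2]
          exact (hΛ _ ω _ _ hω hs).1) t ht
      have u2 := comparison_step (g := fun t => M t ω - N t ω) (g' := fun s => Mt s ω - Nt s ω)
        hΛ0 hC0 hA hη.le (iM.sub iN) (fun t ht => by
          have := dW t ht
          rw [← neg_sub (N t ω), this, ← intervalIntegral.integral_neg]
          simp only [neg_sub]) (by
          filter_upwards [hcmp, h1, h2] with s hs e1 e2
          rw [e1, e2]
          exact (hΛ _ ω _ _ hω hs).2) t ht
      rw [abs_le]
      constructor <;> linarith
    -- The estimate holds for almost every `ω` and all `t`; continuity in `ω` of the time slices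
    -- upgrades it to every `ω`.
    filter_upwards [hLN, hLM, hIoo] with t h1 h2 ht
    refine abs_le_of_ae_halfLine (f := fun ω => N t ω - M t ω)
      (h1.continuousOn.sub h2.continuousOn) ?_
    filter_upwards [hall] with ω hω using hω t ⟨ht.1.le, ht.2.le⟩
  have small : ∀ η, 0 < η → ∀ᵐ t ∂(timeInterval τ), ∀ ω, 0 < ω →
      |N t ω - M t ω| ≤ Real.exp (C * t) * (η * t) := by
    intro η hη
    obtain ⟨r, hr0, hr1, hr⟩ := step η hη
    have iter : ∀ n : ℕ, ∀ᵐ t ∂(timeInterval τ), ∀ ω, 0 < ω →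
        |N t ω - M t ω| ≤ Real.exp (C * t) * (2 * |B| * r ^ n + η * t) := by
      intro n
      induction n with
      | zero =>
        filter_upwards [hLN, hLM, hIoo] with t h1 h2 ht ω hω
        have a1 := (h1.bound ω hω).trans (le_abs_self B)
        have a2 := (h2.bound ω hω).trans (le_abs_self B)
        have a3 : 1 ≤ Real.exp (C * t) := Real.one_le_exp (mul_nonneg hC0 ht.1.le)
        have a4 : 0 ≤ η * t := mul_nonneg hη.le ht.1.le
        refine (abs_sub _ _).trans ?_
        rw [pow_zero, mul_one]
        have a5 : 2 * |B| + η * t ≤ Real.exp (C * t) * (2 * |B| + η * t) :=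
          le_mul_of_one_le_left (by positivity) a3
        linarith
      | succ n ih =>
        have := hr _ (by positivity) ih
        simpa only [pow_succ, mul_assoc] using this
    filter_upwards [ae_all_iff.2 iter] with t ht ω hω
    have hlim : Filter.Tendsto (fun n : ℕ => Real.exp (C * t) * (2 * |B| * r ^ n + η * t))
        Filter.atTop (nhds (Real.exp (C * t) * (2 * |B| * 0 + η * t))) :=
      (((tendsto_pow_atTop_nhds_zero_of_lt_one hr0 hr1).const_mul _).add_const _).const_mul _
    rw [mul_zero, zero_add] at hlim
    exact ge_of_tendsto' hlim fun n => ht n ω hω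
  -- A countable sequence of values of `η` keeps a single exceptional null set of times.
  have small' : ∀ n : ℕ, ∀ᵐ t ∂(timeInterval τ), ∀ ω, 0 < ω →
      |N t ω - M t ω| ≤ Real.exp (C * t) * (1 / ((n : ℝ) + 1) * t) := fun n =>
    small _ Nat.one_div_pos_of_nat
  filter_upwards [ae_all_iff.2 small'] with t ht ω hω
  have hlim : Filter.Tendsto (fun n : ℕ => Real.exp (C * t) * (1 / ((n : ℝ) + 1) * t))
      Filter.atTop (nhds (Real.exp (C * t) * (0 * t))) :=
    ((tendsto_one_div_add_atTop_nhds_zero_nat).mul_const _).const_mul _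
  rw [zero_mul, mul_zero] at hlim
  have := ge_of_tendsto' hlim fun n => ht n ω hω
  exact sub_eq_zero.1 (abs_nonpos_iff.1 this)

end KineticMMT
end

noncomputable section

namespace KineticMMT

/-! ### Functionals of a time slice -/

/-- The integrand in time of `roughness`. -/
def roughnessSlice (β : ℝ) (F : ℝ → ℝ) : ℝ≥0∞ :=
  ∫⁻ ω in Ioi (0 : ℝ), ∫⁻ u in Ioo (-1 / 3 : ℝ) 1,
    ENNReal.ofReal (|F ω - F (ω * (1 + u))| ^ 2 * kernel β u)

variable {β : ℝ} {p₀ : ℕ} {f g F : ℝ → ℝ}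

theorem D_congr (h : ∀ ω, 0 < ω → f ω = g ω) {ω : ℝ} (hω : 0 < ω) : D f ω = D g ω := by
  have : f =ᶠ[nhds ω] g := by
    filter_upwards [Ioi_mem_nhds hω] with x hx using h x hx
  rw [D, D, this.deriv_eq]

theorem xNorm_congr (h : ∀ ω, 0 < ω → f ω = g ω) : xNorm p₀ f = xNorm p₀ g := by
  have h1 : f =ᵐ[halfLine] g := by
    filter_upwards [ae_restrict_mem measurableSet_Ioi] with x hx using h x hx
  have h2 : D f =ᵐ[halfLine] D g := by
    filter_upwards [ae_restrict_mem measurableSet_Ioi] with x hx using D_congr h hx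
  rw [xNorm, xNorm, eLpNorm_congr_ae h1, eLpNorm_congr_ae h2, eLpNorm_congr_ae h2]

theorem roughnessSlice_congr {G : ℝ → ℝ} (h : ∀ ω, 0 < ω → F ω = G ω) :
    roughnessSlice β F = roughnessSlice β G := by
  refine setLIntegral_congr_fun measurableSet_Ioi fun ω hω => ?_
  refine setLIntegral_congr_fun measurableSet_Ioo fun u hu => ?_
  have hω' : (0 : ℝ) < ω := hω
  have : 0 < ω * (1 + u) := mul_pos hω' (by linarith [hu.1])
  simp only [h ω hω', h _ this]

theorem measurable_D (f : ℝ → ℝ) : Measurable (D f) := measurable_id.mul (measurable_deriv f)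

theorem le_kernel_of_nonneg {u : ℝ} (hu : u ∈ Icc (0 : ℝ) 1) : |u| ^ (2 * β) ≤ kernel β u := by
  rw [kernel, indicator_of_mem hu]
  exact le_add_of_nonneg_left (indicator_nonneg (fun _ _ => by positivity) _)

theorem le_kernel_of_nonpos {u : ℝ} (hu : u ∈ Icc (-1 / 3 : ℝ) 0) :
    |u| ^ (-(β + 1)) ≤ kernel β u := by
  rw [kernel, indicator_of_mem hu]
  exact le_add_of_nonneg_right (indicator_nonneg (fun _ _ => by positivity) _)

/-- The derivative is bounded only almost everywhere, so its bound at the shifted frequency requires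
that the affine map in `u` pull null sets back to null sets. -/
theorem ae_comp_mul_one_add {p : ℝ → Prop} (hp : ∀ᵐ x, p x) {ω : ℝ} (hω : ω ≠ 0) :
    ∀ᵐ u, p (ω * (1 + u)) := by
  have h1 : Measure.QuasiMeasurePreserving (fun x : ℝ => ω * x) volume volume := by
    refine ⟨measurable_const_mul ω, ?_⟩
    rw [Real.map_volume_mul_left hω]
    exact Measure.smul_absolutelyContinuous
  exact (measurePreserving_add_left volume (1 : ℝ)).quasiMeasurePreserving.ae (h1.ae hp)

theorem integral_segment_pow_le {a b B : ℝ} (ha : |a| ≤ B) (hb : |b| ≤ B) (n : ℕ) :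
    ∫ θ in (0 : ℝ)..1, |θ * a + (1 - θ) * b| ^ n ≤ B ^ n := by
  have := intervalIntegral.norm_integral_le_of_norm_le_const (a := (0 : ℝ)) (b := 1)
    (f := fun θ => |θ * a + (1 - θ) * b| ^ n) (C := B ^ n) (fun θ hθ => by
      rw [uIoc_of_le zero_le_one] at hθ
      rw [norm_pow, Real.norm_eq_abs, abs_abs]
      refine pow_le_pow_left₀ (abs_nonneg _) ?_ n
      refine (abs_add_le _ _).trans ?_
      rw [abs_mul, abs_mul, abs_of_pos hθ.1, abs_of_nonneg (sub_nonneg.2 hθ.2)]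
      nlinarith [hθ.1, hθ.2])
  rw [sub_zero, abs_one, mul_one] at this
  exact (le_abs_self _).trans this

/-- A weighted quadratic functional of increments is controlled by its unweighted version. -/
theorem lintegral_segment_le {B : ℝ} (hB0 : 0 ≤ B) (hF : ∀ᵐ x ∂halfLine, |F x| ≤ B) (n : ℕ)
    {I : Set ℝ} (hI : MeasurableSet I) (hsub : I ⊆ Ioo (-1 / 3 : ℝ) 1) {w : ℝ → ℝ}
    (hw : ∀ u ∈ I, 0 ≤ w u ∧ w u ≤ kernel β u) :
    ∫⁻ ω in Ioi (0 : ℝ), ∫⁻ u in I, ENNReal.ofReal (|F ω - F (ω * (1 + u))| ^ 2 * w u *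
      ∫ θ in (0 : ℝ)..1, |θ * F ω + (1 - θ) * F (ω * (1 + u))| ^ n) ≤
      ENNReal.ofReal (B ^ n) * roughnessSlice β F := by
  rw [roughnessSlice, ← lintegral_const_mul' _ _ ENNReal.ofReal_ne_top]
  refine lintegral_mono_ae ?_
  filter_upwards [hF, ae_restrict_mem measurableSet_Ioi] with ω hFω hω
  have hω0 : (0 : ℝ) < ω := hω
  rw [← lintegral_const_mul' _ _ ENNReal.ofReal_ne_top]
  refine le_trans (lintegral_mono_ae ?_) (lintegral_mono_set hsub)
  rw [halfLine, ae_restrict_iff' measurableSet_Ioi] at hF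
  refine (ae_restrict_iff' hI).2 ?_
  filter_upwards [ae_comp_mul_one_add hF hω0.ne'] with u hu huI
  have hu' := hu (mul_pos hω0 (by linarith [(hsub huI).1]))
  rw [← ENNReal.ofReal_mul (by positivity)]
  refine ENNReal.ofReal_le_ofReal ?_
  rw [mul_comm]
  obtain ⟨w0, w1⟩ := hw u huI
  exact mul_le_mul (integral_segment_pow_le hFω hu' n)
    (mul_le_mul_of_nonneg_left w1 (by positivity)) (by positivity) (by positivity)

theorem lintegral_smoothing_right_le {B : ℝ} (hB0 : 0 ≤ B) (hF : ∀ᵐ x ∂halfLine, |F x| ≤ B)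
    (n : ℕ) :
    ∫⁻ ω in Ioi (0 : ℝ), ∫⁻ u in Ioo (0 : ℝ) 1,
      ENNReal.ofReal (|F ω - F (ω * (1 + u))| ^ 2 * u ^ (2 * β) *
        ∫ θ in (0 : ℝ)..1, |θ * F ω + (1 - θ) * F (ω * (1 + u))| ^ n) ≤
      ENNReal.ofReal (B ^ n) * roughnessSlice β F := by
  refine lintegral_segment_le hB0 hF n measurableSet_Ioo (Ioo_subset_Ioo_left (by norm_num))
    (w := fun u => u ^ (2 * β)) fun u hu => ⟨Real.rpow_nonneg hu.1.le _, ?_⟩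
  have := le_kernel_of_nonneg (β := β) ⟨hu.1.le, hu.2.le⟩
  rwa [abs_of_pos hu.1] at this

theorem lintegral_smoothing_left_le {B : ℝ} (hB0 : 0 ≤ B) (hF : ∀ᵐ x ∂halfLine, |F x| ≤ B)
    (n : ℕ) :
    ∫⁻ ω in Ioi (0 : ℝ), ∫⁻ u in Ioo (0 : ℝ) (1 / 3),
      ENNReal.ofReal (|F ω - F (ω * (1 - u))| ^ 2 * u ^ (-(β + 1)) *
        ∫ θ in (0 : ℝ)..1, |θ * F ω + (1 - θ) * F (ω * (1 - u))| ^ n) ≤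
      ENNReal.ofReal (B ^ n) * roughnessSlice β F := by
  have key := lintegral_segment_le (β := β) hB0 hF n (I := Ioo (-1 / 3 : ℝ) 0) measurableSet_Ioo
    (Ioo_subset_Ioo_right (by norm_num)) (w := fun u => (-u) ^ (-(β + 1))) fun u hu =>
      ⟨Real.rpow_nonneg (by linarith [hu.2]) _, by
        have := le_kernel_of_nonpos (β := β) ⟨hu.1.le, hu.2.le⟩
        rwa [abs_of_neg hu.2] at this⟩
  refine le_trans (le_of_eq (lintegral_congr fun ω => ?_)) key
  rw [← (Measure.measurePreserving_neg (volume : Measure ℝ)).setLIntegral_comp_preimage_emb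
    (MeasurableEquiv.neg ℝ).measurableEmbedding]
  have hset : Neg.neg ⁻¹' Ioo (0 : ℝ) (1 / 3) = Ioo (-1 / 3 : ℝ) 0 := by
    ext x; simp only [mem_preimage, mem_Ioo]; constructor <;> rintro ⟨h1, h2⟩ <;>
      constructor <;> linarith
  rw [hset]
  simp only [sub_neg_eq_add]

/-! ### Comparison of the fractional seminorm with the roughness -/

/-- The integrand of the fractional seminorms with the ratio of the frequencies in `s`. -/
def ratioIntegrand (s : Set ℝ) (e d : ℝ) (F : ℝ → ℝ) (ω ω' : ℝ) : ℝ≥0∞ :=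
  ENNReal.ofReal (s.indicator 1 (ω' / ω) * (|F ω - F ω'| ^ 2 / |ω' - ω| ^ e) * (ω * ω') ^ d)

theorem measurable_ratioIntegrand {s : Set ℝ} (hs : MeasurableSet s) (e d : ℝ)
    (hF : Measurable F) : Measurable (Function.uncurry (ratioIntegrand s e d F)) := by
  have h1 : Measurable fun z : ℝ × ℝ => s.indicator (1 : ℝ → ℝ) (z.2 / z.1) :=
    (measurable_one.indicator hs).comp (measurable_snd.div measurable_fst)
  have h2 : Measurable fun z : ℝ × ℝ => |F z.1 - F z.2| ^ 2 :=
    ((hF.comp measurable_fst).sub (hF.comp measurable_snd)).abs.pow_const 2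
  have h3 : Measurable fun z : ℝ × ℝ => |z.2 - z.1| ^ e :=
    (measurable_snd.sub measurable_fst).abs.pow_const e
  have h4 : Measurable fun z : ℝ × ℝ => (z.1 * z.2) ^ d :=
    (measurable_fst.mul measurable_snd).pow_const d
  exact ((h1.mul (h2.div h3)).mul h4).ennreal_ofReal

/-- Apart from the indicator, the integrand is symmetric in the two frequencies, so ratios on one
side of one can be folded onto the other. -/
theorem ratioIntegrand_le_add_swap {s S : Set ℝ} (hS : ∀ x, 0 < x → x ∈ S → x ∈ s ∨ x⁻¹ ∈ s)
    (e d : ℝ) {ω ω' : ℝ} (hω : 0 < ω) (hω' : 0 < ω') :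
    ratioIntegrand S e d F ω ω' ≤ ratioIntegrand s e d F ω ω' + ratioIntegrand s e d F ω' ω := by
  by_cases h : ω' / ω ∈ S
  · rcases hS _ (div_pos hω' hω) h with h1 | h1
    · refine le_add_right (le_of_eq ?_)
      simp only [ratioIntegrand, indicator_of_mem h, indicator_of_mem h1]
    · rw [inv_div] at h1
      refine le_add_left (le_of_eq ?_)
      simp only [ratioIntegrand, indicator_of_mem h, indicator_of_mem h1]
      rw [abs_sub_comm (F ω), abs_sub_comm ω', mul_comm ω]
      rfl
  · simp [ratioIntegrand, indicator_of_notMem h]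

theorem lintegral_eq_mul_lintegral_comp {G : ℝ → ℝ≥0∞} (hG : Measurable G) {ω : ℝ} (hω : 0 < ω) :
    ∫⁻ x, G x = ENNReal.ofReal ω * ∫⁻ u, G (ω * (1 + u)) := by
  rw [lintegral_add_left_eq_self (μ := volume) (fun x => G (ω * x)) 1,
    ← lintegral_map hG (measurable_const_mul ω), Real.map_volume_mul_left hω.ne',
    lintegral_smul_measure, smul_eq_mul, ← mul_assoc, ← ENNReal.ofReal_mul hω.le,
    abs_of_pos (inv_pos.2 hω), mul_inv_cancel₀ hω.ne', ENNReal.ofReal_one, one_mul]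

/-- With `ω' = ω * (1 + u)`, the relation `e = 2d + 1` is scale invariance: the powers of `ω` from
the denominator, the weight and the Jacobian cancel. What remains is `(1 + u) ^ d`, bounded for
ratios in `[2/3, 2]`, and `|u| ^ (-e)`. -/
theorem exists_ratio_lintegral_le (β : ℝ) {s S : Set ℝ} (hs : MeasurableSet s)
    (hs' : s ⊆ Icc (2 / 3) 2) (hS : ∀ x, 0 < x → x ∈ S → x ∈ s ∨ x⁻¹ ∈ s) {e d : ℝ}
    (he : e = 2 * d + 1) (hk : ∀ u, 1 + u ∈ s → |u| ^ (-e) ≤ kernel β u) :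
    ∃ c : ℝ≥0, ∀ F : ℝ → ℝ, Measurable F →
      ∫⁻ ω in Ioi (0 : ℝ), ∫⁻ ω' in Ioi (0 : ℝ), ratioIntegrand S e d F ω ω' ≤
        c * roughnessSlice β F := by
  obtain ⟨K, hK1, hK⟩ := exists_rpow_bound d
  refine ⟨2 * K.toNNReal, fun F hF => ?_⟩
  have hJ := measurable_ratioIntegrand hs e d hF
  have hJ1 : ∀ ω, Measurable (ratioIntegrand s e d F ω) := fun ω => hJ.of_uncurry_left
  -- one-sided estimate
  have one : ∫⁻ ω in Ioi (0 : ℝ), ∫⁻ ω' in Ioi (0 : ℝ), ratioIntegrand s e d F ω ω' ≤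
      ENNReal.ofReal K * roughnessSlice β F := by
    rw [roughnessSlice, ← lintegral_const_mul' _ _ ENNReal.ofReal_ne_top]
    refine setLIntegral_mono' measurableSet_Ioi fun ω hω => ?_
    have hω0 : (0 : ℝ) < ω := hω
    refine (setLIntegral_le_lintegral _ _).trans ?_
    rw [lintegral_eq_mul_lintegral_comp (hJ1 ω) hω0,
      ← lintegral_const_mul' _ _ ENNReal.ofReal_ne_top,
      ← lintegral_const_mul' _ _ ENNReal.ofReal_ne_top, restrict_Ioo_eq_restrict_Icc,
      ← lintegral_indicator measurableSet_Icc]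
    refine lintegral_mono fun u => ?_
    have hr : ω * (1 + u) / ω = 1 + u := by field_simp
    by_cases h : 1 + u ∈ s
    · obtain ⟨u1, u2⟩ := hs' h
      have hu : u ∈ Icc (-1 / 3 : ℝ) 1 := ⟨by linarith, by linarith⟩
      have hu1 : 0 < 1 + u := by linarith
      rw [indicator_of_mem hu, ← ENNReal.ofReal_mul (by linarith), ratioIntegrand,
        ← ENNReal.ofReal_mul hω0.le, hr, indicator_of_mem h]
      refine ENNReal.ofReal_le_ofReal ?_
      have e1 : |ω * (1 + u) - ω| ^ e = ω ^ e * |u| ^ e := by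
        rw [show ω * (1 + u) - ω = ω * u by ring, abs_mul, abs_of_pos hω0,
          Real.mul_rpow hω0.le (abs_nonneg _)]
      have e2 : (ω * (ω * (1 + u))) ^ d = ω ^ (2 * d) * (1 + u) ^ d := by
        rw [← mul_assoc, Real.mul_rpow (by positivity) hu1.le, Real.mul_rpow hω0.le hω0.le,
          ← Real.rpow_add hω0, two_mul]
      have e3 : ω ^ e = ω ^ (2 * d) * ω := by rw [he, Real.rpow_add_one hω0.ne']
      have e4 : ω * ((1 : ℝ → ℝ) (1 + u) * (|F ω - F (ω * (1 + u))| ^ 2 / |ω * (1 + u) - ω| ^ e) *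
          (ω * (ω * (1 + u))) ^ d) =
          (1 + u) ^ d * (|F ω - F (ω * (1 + u))| ^ 2 * |u| ^ (-e)) := by
        have hpos : ω ^ (2 * d) ≠ 0 := (Real.rpow_pos_of_pos hω0 _).ne'
        rw [e1, e2, e3, Real.rpow_neg (abs_nonneg u), Pi.one_apply, one_mul, div_eq_mul_inv,
          mul_inv, mul_inv]
        field_simp
      rw [e4]
      exact mul_le_mul (hK _ ⟨by linarith, by linarith⟩).1
        (mul_le_mul_of_nonneg_left (hk u h) (by positivity)) (by positivity) (by linarith)
    · rw [ratioIntegrand, hr, indicator_of_notMem h]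
      simp
  have swap : ∫⁻ ω in Ioi (0 : ℝ), ∫⁻ ω' in Ioi (0 : ℝ), ratioIntegrand s e d F ω' ω =
      ∫⁻ ω in Ioi (0 : ℝ), ∫⁻ ω' in Ioi (0 : ℝ), ratioIntegrand s e d F ω ω' :=
    lintegral_lintegral_swap (hJ.comp measurable_swap).aemeasurable
  calc ∫⁻ ω in Ioi (0 : ℝ), ∫⁻ ω' in Ioi (0 : ℝ), ratioIntegrand S e d F ω ω'
      ≤ ∫⁻ ω in Ioi (0 : ℝ), ∫⁻ ω' in Ioi (0 : ℝ),
          (ratioIntegrand s e d F ω ω' + ratioIntegrand s e d F ω' ω) :=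
        setLIntegral_mono' measurableSet_Ioi fun ω hω =>
          setLIntegral_mono' measurableSet_Ioi fun ω' hω' =>
            ratioIntegrand_le_add_swap hS e d hω hω'
    _ = (∫⁻ ω in Ioi (0 : ℝ), ∫⁻ ω' in Ioi (0 : ℝ), ratioIntegrand s e d F ω ω') +
          ∫⁻ ω in Ioi (0 : ℝ), ∫⁻ ω' in Ioi (0 : ℝ), ratioIntegrand s e d F ω' ω := by
        have hm : Measurable fun ω => ∫⁻ ω' in Ioi (0 : ℝ), ratioIntegrand s e d F ω ω' :=
          hJ.lintegral_prod_right'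
        rw [← lintegral_add_left hm]
        exact lintegral_congr fun ω => lintegral_add_left (hJ1 ω) _
    _ ≤ ENNReal.ofReal K * roughnessSlice β F + ENNReal.ofReal K * roughnessSlice β F := by
        rw [swap]; exact add_le_add one one
    _ = _ := by
        rw [← two_mul, ENNReal.coe_mul, mul_assoc]
        rfl

/-- The fractional seminorm is controlled by the roughness. -/
theorem exists_seminormSq_le (β : ℝ) : ∃ c : ℝ≥0, ∀ F : ℝ → ℝ, Measurable F →
    seminormSq β F ≤ c * roughnessSlice β F := by
  -- Ratios are folded into `[2/3, 1]`, that is `u ∈ [-1/3, 0]`, where the kernel contains `|u| ^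
  -- (-(β + 1))`; the second term uses `[1, 2]`, that is `u ∈ [0, 1]`.
  obtain ⟨c₁, h₁⟩ := exists_ratio_lintegral_le β (s := Icc (2 / 3 : ℝ) 1)
    (S := Icc (2 / 3 : ℝ) (3 / 2)) (e := β + 1) (d := β / 2) measurableSet_Icc
    (Icc_subset_Icc_right (by norm_num)) (fun x hx hxS => by
      rcases le_total x 1 with h | h
      · exact Or.inl ⟨hxS.1, h⟩
      · refine Or.inr ⟨?_, inv_le_one_of_one_le₀ h⟩
        rw [le_inv_comm₀ (by norm_num) hx]
        exact hxS.2.trans (by norm_num)) (by ring)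
    (fun u hu => le_kernel_of_nonpos ⟨by linarith [hu.1], by linarith [hu.2]⟩)
  obtain ⟨c₂, h₂⟩ := exists_ratio_lintegral_le β (s := Icc (1 : ℝ) 2)
    (S := Icc (1 / 2 : ℝ) 2) (e := -2 * β) (d := -(2 * β + 1) / 2) measurableSet_Icc
    (Icc_subset_Icc_left (by norm_num)) (fun x hx hxS => by
      rcases le_total 1 x with h | h
      · exact Or.inl ⟨h, hxS.2⟩
      · refine Or.inr ⟨(one_le_inv₀ hx).2 h, ?_⟩
        rw [inv_le_comm₀ hx (by norm_num)]
        exact le_trans (by norm_num) hxS.1) (by ring)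
    (fun u hu => by
      rw [show -(-2 * β) = 2 * β by ring]
      exact le_kernel_of_nonneg ⟨by linarith [hu.1], by linarith [hu.2]⟩)
  refine ⟨c₁ + c₂, fun F hF => ?_⟩
  rw [ENNReal.coe_add, add_mul]
  exact add_le_add (h₁ F hF) (h₂ F hF)

end KineticMMT

end

/-! ### The a priori bounds -/

/-- A priori bounds for strong solutions with finite roughness. By `IsStrongSolution.ae_eq` such a
solution is determined by `N₀` as long as it is nonnegative, which it is on a time interval bounded
below in terms of `inf N₀` and its speed. All the constants can therefore be taken from one solution
with initial value `N₀`, and the bounds hold on every common interval of existence. -/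
theorem mainTheorem3 (β : ℝ) (p₀ : ℕ) (N₀ : ℝ → ℝ)
    (hβ : β ∈ Ioo (-1 : ℝ) 1) (hp₀_pos : 0 < p₀)
    (hp₀ : max (1 / (4 * (1 - β))) (1 / (4 * (1 + β))) < (p₀ : ℝ))
    (hN₀ : KineticMMT.MemX p₀ N₀) (hN₀_inf : 0 < sInf (N₀ '' Ioi 0)) :
    ∃ (Tmax : ℝ) (C C' : ℝ≥0) (K : ℕ → ℝ≥0), 0 < Tmax ∧
      ∀ (T : ℝ) (N Nt : ℝ → ℝ → ℝ), 0 < T →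
        KineticMMT.IsStrongSolution β p₀ T N₀ N Nt →
        KineticMMT.roughness β T N < ∞ →
        essSup (fun t => KineticMMT.xNorm p₀ (N t))
            (KineticMMT.timeInterval (min T Tmax)) ≤ (C : ℝ≥0∞) ∧
        (∀ p : ℕ, p₀ ≤ p → KineticMMT.smoothing β p (min T Tmax) N ≤ (K p : ℝ≥0∞)) ∧
        (β ∈ Ioo (-3 / 4 : ℝ) (3 / 4) →
          ∫⁻ t in Ioo 0 (min T Tmax),
            KineticMMT.seminormSq β (KineticMMT.D (N t)) ≤ (C' : ℝ≥0∞)) := by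
  -- If no solution starts from `N₀`, any constants serve; otherwise one solution is fixed and
  -- supplies them all.
  open KineticMMT in
  by_cases hex : ∃ (T₁ : ℝ) (M Mt : ℝ → ℝ → ℝ), 0 < T₁ ∧ IsStrongSolution β p₀ T₁ N₀ M Mt ∧
      roughness β T₁ M < ∞
  swap
  · exact ⟨1, 0, 0, 0, one_pos, fun T N Nt hT hN hr => (hex ⟨T, N, Nt, hT, hN, hr⟩).elim⟩
  obtain ⟨T₁, M, Mt, hT₁, hM, hrM⟩ := hex
  obtain ⟨L, hL0, hL⟩ := hM.exists_abs_sub_le hN₀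
  obtain ⟨c, hc⟩ := exists_seminormSq_le β
  set a := sInf (N₀ '' Ioi 0) with ha
  have hbdd : BddBelow (N₀ '' Ioi 0) := by
    have hl : LogLip (xNorm p₀ N₀).toNNReal N₀ :=
      hN₀.logLip (ENNReal.coe_toNNReal hN₀.2.ne).ge
    refine ⟨-((xNorm p₀ N₀).toNNReal : ℝ), ?_⟩
    rintro _ ⟨x, hx, rfl⟩
    exact (abs_le.1 (hl.bound x hx)).1
  set C := (essSup (fun t => xNorm p₀ (M t)) (timeInterval T₁)).toNNReal
  set R := (roughness β T₁ M).toNNReal with hR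
  have hRe : (R : ℝ≥0∞) = roughness β T₁ M := ENNReal.coe_toNNReal hrM.ne
  -- Up to time `a / (L + 1)` the reference solution satisfies `M ≥ a - L * t ≥ 0`; the added one
  -- covers `L = 0`. The factor `2` counts the two integrals in `smoothing`.
  refine ⟨min T₁ (a / (L + 1)), C, c * R, fun p => 2 * (C ^ (2 * (p - 1)) * R),
    lt_min hT₁ (by positivity), fun T N Nt hT hN _ => ?_⟩
  set τ := min T (min T₁ (a / (L + 1)))
  have hτT : τ ≤ T := min_le_left _ _
  have hτT₁ : τ ≤ T₁ := (min_le_right _ _).trans (min_le_left _ _)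
  have hτa : τ ≤ a / (L + 1) := (min_le_right _ _).trans (min_le_right _ _)
  have hpos : ∀ᵐ t ∂(timeInterval τ), ∀ ω, 0 < ω → 0 ≤ M t ω := by
    filter_upwards [ae_mono (timeInterval_mono hτT₁) hL, ae_restrict_mem measurableSet_Ioo]
      with t ht htI ω hω
    have h1 := (abs_le.1 (ht ω hω)).1
    have h2 : a ≤ N₀ ω := csInf_le hbdd ⟨ω, hω, rfl⟩
    have h3 := htI.2.le.trans hτa
    rw [le_div_iff₀ (by linarith)] at h3
    nlinarith [htI.1]
  have heq := hN.ae_eq hβ hM hτT hτT₁ hpos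
  have hx : ∀ᵐ t ∂(timeInterval τ), xNorm p₀ (N t) ≤ C := by
    filter_upwards [heq, ae_mono (timeInterval_mono hτT₁) hM.ae_xNorm_le] with t h1 h2
    rwa [xNorm_congr h1]
  have hslice : ∀ᵐ t ∂(timeInterval τ),
      roughnessSlice β (D (N t)) = roughnessSlice β (D (M t)) := by
    filter_upwards [heq] with t ht using roughnessSlice_congr fun ω hω => D_congr ht hω
  -- Any slice functional bounded by the roughness of `N` has its slices replaced by those of `M`,
  -- and the time interval is then enlarged to `(0, T₁)`, so the bound no longer depends on `N` or
  -- `T`.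
  have hint : ∀ (b : ℝ≥0) (G : ℝ → ℝ≥0∞),
      (∀ᵐ t ∂(timeInterval τ), G t ≤ b * roughnessSlice β (D (N t))) →
      ∫⁻ t in Ioo 0 τ, G t ≤ (b * R : ℝ≥0) := by
    intro b G hG
    calc ∫⁻ t in Ioo 0 τ, G t ≤ ∫⁻ t in Ioo 0 τ, b * roughnessSlice β (D (M t)) := by
          refine lintegral_mono_ae ?_
          filter_upwards [hG, hslice] with t h1 h2
          rwa [← h2]
      _ ≤ ∫⁻ t in Ioo 0 T₁, b * roughnessSlice β (D (M t)) :=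
          lintegral_mono_set (Ioo_subset_Ioo_right hτT₁)
      _ = b * roughness β T₁ M := lintegral_const_mul' _ _ ENNReal.coe_ne_top
      _ = _ := by rw [← hRe, ENNReal.coe_mul]
  have hD : ∀ᵐ t ∂(timeInterval τ), ∀ᵐ x ∂halfLine, |D (N t) x| ≤ C := by
    filter_upwards [hx] with t ht using ae_abs_le_of_eLpNorm_le (le_add_self.trans ht)
  refine ⟨essSup_le_of_ae_le _ hx, fun p _ => ?_, fun _ => ?_⟩
  · have hof : ENNReal.ofReal ((C : ℝ) ^ (2 * (p - 1))) = ((C ^ (2 * (p - 1)) : ℝ≥0) : ℝ≥0∞) := by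
      rw [← NNReal.coe_pow, ENNReal.ofReal_coe_nnreal]
    have h1 := hint (C ^ (2 * (p - 1))) (fun t => ∫⁻ ω in Ioi (0 : ℝ), ∫⁻ u in Ioo (0 : ℝ) 1,
      ENNReal.ofReal (|D (N t) ω - D (N t) (ω * (1 + u))| ^ 2 * u ^ (2 * β) *
        ∫ θ in (0 : ℝ)..1,
          |θ * D (N t) ω + (1 - θ) * D (N t) (ω * (1 + u))| ^ (2 * (p - 1)))) (by
      filter_upwards [hD] with t ht
      rw [← hof]
      exact lintegral_smoothing_right_le C.2 ht _)
    have h2 := hint (C ^ (2 * (p - 1))) (fun t => ∫⁻ ω in Ioi (0 : ℝ), ∫⁻ u in Ioo (0 : ℝ) (1 / 3),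
      ENNReal.ofReal (|D (N t) ω - D (N t) (ω * (1 - u))| ^ 2 * u ^ (-(β + 1)) *
        ∫ θ in (0 : ℝ)..1,
          |θ * D (N t) ω + (1 - θ) * D (N t) (ω * (1 - u))| ^ (2 * (p - 1)))) (by
      filter_upwards [hD] with t ht
      rw [← hof]
      exact lintegral_smoothing_left_le C.2 ht _)
    beta_reduce
    rw [two_mul, ENNReal.coe_add]
    exact add_le_add h1 h2
  · refine hint c _ (Filter.Eventually.of_forall fun t => hc _ (measurable_D _))
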